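/- An edge coloring of a finite simple graph $H$ is proper if distinct edges with a common endvertex have different colors. For a properly edge-colored graph $H$, the color-line graph $\mathrm{CL}(H)$ has the edges of $H$ as its vertices, and two distinct edges of $H$ are adjacent in $\mathrm{CL}(H)$ if they share an endvertex or have the same color. A graph $G$ is a proper $2$-color-line graph if $G$ is isomorphic to $\mathrm{CL}(H)$ for some finite simple graph $H$ with a proper edge coloring using at most $2$ colors; such an $H$ is called a properly edge $2$-colored root graph of $G$. Theorem. There is an algorithm (a fixed program for a random access machine with words of $O(\log(n+m+2))$ bits and unit cost for each elementary operation) which, given any finite simple graph $G$ with $n$ vertices and $m$ edges by its adjacency lists, decides in time $O(n+m+1)$, that is, in linear time, whether $G$ is a proper $2$-color-line graph. If $G$ is a proper $2$-color-line graph, then the algorithm also constructs, within the same linear time bound, a properly edge $2$-colored root graph $H$ of $G$ with $O(n+m+1)$ vertices: it outputs the number of vertices of $H$ and the list of the edges of $H$ with their colors, where the $v$-th edge corresponds to the vertex $v$ of $G$ under an isomorphism from $G$ to $\mathrm{CL}(H)$. -/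

import Mathlib

/-! ### Color-line graphs -/

/-- `φ` is a proper edge coloring: distinct edges with a common endvertex get distinct colors.
(In the line graph, two distinct edges are adjacent when they share an endvertex.) -/
def IsProperEdgeColoring {W C : Type*} {H : SimpleGraph W} (φ : H.edgeSet → C) : Prop :=
  ∀ e f : H.edgeSet, H.lineGraph.Adj e f → φ e ≠ φ f

/-- The color-line graph of the edge-colored graph `(H, φ)`: its vertices are the edges of `H`,
and two distinct edges are adjacent if they are incident or have the same color. -/
def colorLineGraph {W C : Type*} (H : SimpleGraph W) (φ : H.edgeSet → C) :
    SimpleGraph H.edgeSet where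
  Adj e f := H.lineGraph.Adj e f ∨ (e ≠ f ∧ φ e = φ f)
  symm := ⟨fun _ _ h => h.imp (fun h => h.symm) (fun h => ⟨h.1.symm, h.2.symm⟩)⟩
  loopless := ⟨fun _ h => h.elim (fun h => h.ne rfl) (fun h => h.1 rfl)⟩

/-- `G` is a proper `k`-color-line graph: it is isomorphic to the color-line graph of a finite
graph `H` with a proper edge coloring that uses (at most) `k` colors. -/
def IsProperColorLineGraph {V : Type*} (k : ℕ) (G : SimpleGraph V) : Prop :=
  ∃ (W : Type) (_ : Finite W) (H : SimpleGraph W) (φ : H.edgeSet → Fin k),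
    IsProperEdgeColoring φ ∧ Nonempty (G ≃g colorLineGraph H φ)

/-! ### A random access machine with bounded words -/

namespace RAM

/-- A configuration of the data of the machine: registers and memory cells hold natural
numbers. -/
structure State where
  reg : ℕ → ℕ
  mem : ℕ → ℕ

/-- Arithmetic expressions; `load e` is the content of the memory cell with address `e`
(indirect addressing), `sub` is truncated subtraction. -/
inductive Expr where
  | const (k : ℕ)
  | reg (r : ℕ)
  | load (e : Expr)
  | add (e f : Expr)
  | sub (e f : Expr)
  | mul (e f : Expr)

/-- The value of an expression. -/
def Expr.eval (s : State) : Expr → ℕ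
  | .const k => k
  | .reg r => s.reg r
  | .load e => s.mem (e.eval s)
  | .add e f => e.eval s + f.eval s
  | .sub e f => e.eval s - f.eval s
  | .mul e f => e.eval s * f.eval s

/-- The number of elementary operations that evaluate an expression: every node counts one. -/
def Expr.cost : Expr → ℕ
  | .const _ => 1
  | .reg _ => 1
  | .load e => e.cost + 1
  | .add e f => e.cost + f.cost + 1
  | .sub e f => e.cost + f.cost + 1
  | .mul e f => e.cost + f.cost + 1

/-- All values (hence also all addresses) that occur in the evaluation are at most `B`, so that
they fit into one machine word. -/
def Expr.Fits (B : ℕ) (s : State) : Expr → Prop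
  | .const k => k ≤ B
  | .reg r => s.reg r ≤ B
  | .load e => e.Fits B s ∧ s.mem (e.eval s) ≤ B
  | .add e f => e.Fits B s ∧ f.Fits B s ∧ e.eval s + f.eval s ≤ B
  | .sub e f => e.Fits B s ∧ f.Fits B s
  | .mul e f => e.Fits B s ∧ f.Fits B s ∧ e.eval s * f.eval s ≤ B

/-- Programs. `branch e P Q` executes `P` if the value of `e` is nonzero and `Q` otherwise;
`loop e P` repeats `P` as long as the value of `e` is nonzero. -/
inductive Program where
  | nop
  | assign (r : ℕ) (e : Expr)
  | store (addr e : Expr)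
  | seq (P Q : Program)
  | branch (e : Expr) (P Q : Program)
  | loop (e : Expr) (P : Program)

/-- `Run B P s t s'`: started in `s`, the program `P` halts after exactly `t` steps in `s'`, and
all values computed on the way are at most `B`. There is no rule for an expression with a larger
value: the machine is then stuck and does not halt. -/
inductive Run (B : ℕ) : Program → State → ℕ → State → Prop where
  | nop (s : State) : Run B .nop s 1 s
  | assign (s : State) (r : ℕ) (e : Expr) (he : e.Fits B s) :
      Run B (.assign r e) s (e.cost + 1) { s with reg := Function.update s.reg r (e.eval s) }
  | store (s : State) (addr e : Expr) (ha : addr.Fits B s) (he : e.Fits B s) :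
      Run B (.store addr e) s (addr.cost + e.cost + 1)
        { s with mem := Function.update s.mem (addr.eval s) (e.eval s) }
  | seq {s₁ s₂ s₃ : State} {P Q : Program} {t₁ t₂ : ℕ}
      (hP : Run B P s₁ t₁ s₂) (hQ : Run B Q s₂ t₂ s₃) : Run B (.seq P Q) s₁ (t₁ + t₂) s₃
  | branch_true {s s' : State} {e : Expr} {P Q : Program} {t : ℕ} (he : e.Fits B s)
      (hc : e.eval s ≠ 0) (hP : Run B P s t s') : Run B (.branch e P Q) s (e.cost + 1 + t) s'
  | branch_false {s s' : State} {e : Expr} {P Q : Program} {t : ℕ} (he : e.Fits B s)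
      (hc : e.eval s = 0) (hQ : Run B Q s t s') : Run B (.branch e P Q) s (e.cost + 1 + t) s'
  | loop_done {s : State} {e : Expr} {P : Program} (he : e.Fits B s) (hc : e.eval s = 0) :
      Run B (.loop e P) s (e.cost + 1) s
  | loop_step {s₁ s₂ s₃ : State} {e : Expr} {P : Program} {t₁ t₂ : ℕ} (he : e.Fits B s₁)
      (hc : e.eval s₁ ≠ 0) (hP : Run B P s₁ t₁ s₂) (hL : Run B (.loop e P) s₂ t₂ s₃) :
      Run B (.loop e P) s₁ (e.cost + 1 + t₁ + t₂) s₃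

/-- The initial state on an input word: the input stands in the memory cells `0, 1, 2, …`, and
all other cells and all registers are `0`. -/
def State.init (input : List ℕ) : State where
  reg := fun _ => 0
  mem := fun i => input.getD i 0

/-- The list `l` stands in consecutive memory cells from address `a` on. -/
def State.HoldsAt (s : State) (a : ℕ) (l : List ℕ) : Prop :=
  ∀ (i : ℕ) (hi : i < l.length), s.mem (a + i) = l[i]

end RAM

/-! ### Graphs as input and output -/

/-- `adj` is an adjacency list representation of `G`: for every vertex a list of its neighbors,
each listed once, in any order. -/
def IsAdjacencyList {n : ℕ} (G : SimpleGraph (Fin n)) (adj : Fin n → List (Fin n)) : Prop :=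
  ∀ v, (adj v).Nodup ∧ ∀ w, w ∈ adj v ↔ G.Adj v w

/-- The adjacency lists as a sequence of numbers: the number `n` of vertices, and then for the
vertices `0, …, n - 1` in turn the degree followed by the neighbors. -/
def encodeAdjacencyList {n : ℕ} (adj : Fin n → List (Fin n)) : List ℕ :=
  n :: (List.finRange n).flatMap fun v => (adj v).length :: (adj v).map fun w => (w : ℕ)

/-- In the state `s`, from the address in register `1` on, the memory holds a graph `H` on
`p ≤ L` vertices `0, …, p - 1` with a proper edge `2`-coloring `φ` whose color-line graph is
isomorphic to `G`. It is written as the number `p` followed by the list of the edges of `H`, each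
once, as triples (endvertex, endvertex, color); the `v`-th edge is the one that corresponds to
the vertex `v` of `G` under the isomorphism `ψ`. -/
def HoldsRootGraph {n : ℕ} (G : SimpleGraph (Fin n)) (L : ℕ) (s : RAM.State) : Prop :=
  ∃ (p : ℕ) (H : SimpleGraph (Fin p)) (φ : H.edgeSet → Fin 2) (ψ : G ≃g colorLineGraph H φ)
    (a b : Fin n → Fin p),
    p ≤ L ∧ IsProperEdgeColoring φ ∧ (∀ v, (ψ v : Sym2 (Fin p)) = s(a v, b v)) ∧
    s.HoldsAt (s.reg 1)
      (p :: (List.finRange n).flatMap fun v => [(a v : ℕ), (b v : ℕ), (φ (ψ v) : ℕ)])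

/-! ### Verifying programs of the random access machine -/

namespace RAM

/-! A graph is a proper 2-color-line graph exactly when its vertices can be 2-colored so that both
color classes are cliques and every vertex has at most two neighbors of the other color
(`IsCliqueColoring`). Necessity (`ncard_cross_le_two`): neighbors of `v` of the other color are
edges of the root meeting the edge of `v`, and properness allows only one of them at each of its two
ends. Conversely, let the edge of `v` join the unordered pairs {v, x} and {v, y}, where x, y are its
neighbors of the other color, padded by the non-vertices `n` and `n + 1`. The edges of distinct `v`,
`w` can then share only the pair {v, w}, and do so exactly when `v`, `w` are adjacent with different
colors (`exists_iso_colorLineGraph`, `Success.holdsRootGraph`).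

To find a coloring, take a vertex `v` with at least five non-neighbors, if there is one. All of
these have the other color. A vertex of the color of `v` has at most three neighbors outside N(v),
namely `v` and two of the other color. A vertex of the other color has at least four, since its
class is a clique containing those five. So counting such neighbors recovers the coloring
(`guess_of_pivot`). If there is no such `v`, two nonempty classes would have at most six vertices
each, so for n > 12 only one color occurs. For n ≤ 12 all colorings are tried.

Everything is linear: a coloring is checked by comparing degrees with class sizes
(`forall_vertexOk_iff`), and the quadratic number of possible pair codes is O(n + m + 1), because
two cliques cover the graph (`sq_le_of_vertexOk`). -/

/-- The state after writing `x` into register `r`. -/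
def State.setReg (s : State) (r x : ℕ) : State := { s with reg := Function.update s.reg r x }

/-- The state after writing `x` into the memory cell `a`. -/
def State.setMem (s : State) (a x : ℕ) : State := { s with mem := Function.update s.mem a x }

@[simp] theorem State.setReg_reg (s : State) (r x q : ℕ) :
    (s.setReg r x).reg q = if q = r then x else s.reg q := by
  simp [State.setReg, Function.update_apply]

@[simp] theorem State.setReg_mem (s : State) (r x : ℕ) : (s.setReg r x).mem = s.mem := rfl

@[simp] theorem State.setMem_reg (s : State) (a x : ℕ) : (s.setMem a x).reg = s.reg := rfl

theorem State.setMem_mem (s : State) (a x b : ℕ) :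
    (s.setMem a x).mem b = if b = a then x else s.mem b := by
  simp [State.setMem, Function.update_apply]

/-- Started in `s`, the program `P` halts within `T` steps in a state with the property `Q`. -/
def Halts (B : ℕ) (P : Program) (s : State) (T : ℕ) (Q : State → Prop) : Prop :=
  ∃ t s', Run B P s t s' ∧ t ≤ T ∧ Q s'

variable {B : ℕ} {P P' : Program} {s : State} {T T' : ℕ} {Q R : State → Prop} {e f : Expr}

theorem Halts.mono (h : Halts B P s T Q) (hT : T ≤ T') (hQ : ∀ s, Q s → R s) :
    Halts B P s T' R := by
  obtain ⟨t, s', hr, ht, hq⟩ := h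
  exact ⟨t, s', hr, ht.trans hT, hQ _ hq⟩

theorem halts_nop (hT : 1 ≤ T) (h : Q s) : Halts B .nop s T Q := ⟨1, s, .nop s, hT, h⟩

theorem halts_assign {r : ℕ} (he : e.Fits B s) (hT : e.cost + 1 ≤ T)
    (h : Q (s.setReg r (e.eval s))) : Halts B (.assign r e) s T Q :=
  ⟨_, _, .assign s r e he, hT, h⟩

theorem halts_store {a x : ℕ} (he : e.Fits B s ∧ f.Fits B s) (ha : e.eval s = a)
    (hx : f.eval s = x) (hT : e.cost + f.cost + 1 ≤ T) (h : Q (s.setMem a x)) :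
    Halts B (.store e f) s T Q := by
  subst ha hx
  exact ⟨_, _, .store s e f he.1 he.2, hT, h⟩

theorem Halts.seq (h : Halts B P s T fun s' => Halts B P' s' T' Q) :
    Halts B (.seq P P') s (T + T') Q := by
  obtain ⟨t, s', hr, ht, t', s'', hr', ht', hq⟩ := h
  exact ⟨_, _, .seq hr hr', by omega, hq⟩

/-- The unspent budget passes to the continuation, so a straight-line program is verified one
instruction at a time. -/
theorem halts_assign_seq {r : ℕ} (he : e.Fits B s) (hT : e.cost + 1 ≤ T)
    (h : Halts B P (s.setReg r (e.eval s)) (T - (e.cost + 1)) Q) :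
    Halts B (.seq (.assign r e) P) s T Q :=
  (Halts.seq (halts_assign he le_rfl h)).mono (by omega) fun _ h => h

theorem halts_store_seq {a x : ℕ} (he : e.Fits B s ∧ f.Fits B s) (ha : e.eval s = a)
    (hx : f.eval s = x) (hT : e.cost + f.cost + 1 ≤ T)
    (h : Halts B P (s.setMem a x) (T - (e.cost + f.cost + 1)) Q) :
    Halts B (.seq (.store e f) P) s T Q :=
  (Halts.seq (halts_store he ha hx le_rfl h)).mono (by omega) fun _ h => h

theorem halts_branch (he : e.Fits B s) (hT : e.cost + 1 ≤ T)
    (h : e.eval s ≠ 0 → Halts B P s (T - (e.cost + 1)) Q)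
    (h' : e.eval s = 0 → Halts B P' s (T - (e.cost + 1)) Q) :
    Halts B (.branch e P P') s T Q := by
  by_cases hc : e.eval s = 0
  · obtain ⟨t, s', hr, ht, hq⟩ := h' hc
    exact ⟨_, _, .branch_false he hc hr, by omega, hq⟩
  · obtain ⟨t, s', hr, ht, hq⟩ := h hc
    exact ⟨_, _, .branch_true he hc hr, by omega, hq⟩

/-- A loop that runs `k` times, with an invariant that counts the rounds. -/
theorem halts_loop (I : ℕ → State → Prop) (T : ℕ → ℕ) (k : ℕ)
    (hstep : ∀ i < k, ∀ s, I i s → e.Fits B s ∧ e.eval s ≠ 0 ∧ Halts B P s (T i) (I (i + 1)))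
    (hdone : ∀ s, I k s → e.Fits B s ∧ e.eval s = 0) (h0 : I 0 s) :
    Halts B (.loop e P) s (∑ i ∈ Finset.range k, (e.cost + 1 + T i) + (e.cost + 1)) (I k) := by
  induction k generalizing I T s with
  | zero => exact ⟨_, s, .loop_done (hdone s h0).1 (hdone s h0).2, by simp, h0⟩
  | succ k ih =>
    obtain ⟨hf, hc, t, s₁, hr, ht, h1⟩ := hstep 0 (by omega) s h0
    -- The first round is peeled off; the remaining ones use the invariant and the costs shifted by
    -- one.
    obtain ⟨t', s₂, hr', ht', h2⟩ := ih (s := s₁) (fun i => I (i + 1)) (fun i => T (i + 1))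
      (fun i hi => hstep (i + 1) (by omega)) hdone h1
    refine ⟨_, _, .loop_step hf hc hr hr', ?_, h2⟩
    rw [Finset.sum_range_succ']
    omega

end RAM

/-! ### Passes over the adjacency lists -/

namespace RAM

/-- The lists `A 0, …, A (n - 1)` look like the adjacency lists of a graph on `n` vertices. -/
structure IsInput (n : ℕ) (A : ℕ → List ℕ) : Prop where
  lt : ∀ v < n, ∀ w ∈ A v, w < n
  length_lt : ∀ v < n, (A v).length < n

/-- The address at which the entry of the vertex `v` starts in the input. -/
def pos (A : ℕ → List ℕ) (v : ℕ) : ℕ := 1 + ∑ u ∈ Finset.range v, ((A u).length + 1)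

theorem pos_succ (A : ℕ → List ℕ) (v : ℕ) : pos A (v + 1) = pos A v + (A v).length + 1 := by
  simp only [pos, Finset.sum_range_succ]; omega

theorem IsInput.pos_le {n : ℕ} {A : ℕ → List ℕ} (hA : IsInput n A) {v : ℕ} (hv : v ≤ n) :
    pos A v ≤ n * n + 1 := by
  have : ∑ u ∈ Finset.range v, ((A u).length + 1) ≤ ∑ u ∈ Finset.range v, n :=
    Finset.sum_le_sum fun u hu => hA.length_lt u (by have := Finset.mem_range.1 hu; omega)
  rw [Finset.sum_const, Finset.card_range, smul_eq_mul] at this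
  have := Nat.mul_le_mul_right n hv
  unfold pos; omega

theorem IsInput.pos_add_le {n : ℕ} {A : ℕ → List ℕ} (hA : IsInput n A) {v : ℕ} (hv : v < n) :
    pos A v + (A v).length + 1 ≤ n * n + 1 := by
  rw [← pos_succ]; exact hA.pos_le hv

/-- The input stands in the memory. -/
structure InputAt (n : ℕ) (A : ℕ → List ℕ) (s : State) : Prop where
  zero : s.mem 0 = n
  length : ∀ v < n, s.mem (pos A v) = (A v).length
  get : ∀ v < n, ∀ (j : ℕ) (hj : j < (A v).length), s.mem (pos A v + 1 + j) = (A v)[j]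

/-- The input is intact, and the registers `1` to `4` hold the start of the output, the number of
vertices, and the starts of two arrays for the colors and the marks of the vertices. -/
structure Ready (n : ℕ) (A : ℕ → List ℕ) (s : State) : Prop where
  input : InputAt n A s
  out : s.reg 1 = n * n + 2 * n + 13
  size : s.reg 2 = n
  color : s.reg 3 = n * n + 1
  mark : s.reg 4 = n * n + n + 13

variable {n : ℕ} {A : ℕ → List ℕ} {s : State}

theorem InputAt.congr {s' : State} (h : InputAt n A s) (hA : IsInput n A)
    (hs : ∀ a < n * n + 1, s'.mem a = s.mem a) : InputAt n A s' where
  zero := by rw [hs _ (by omega), h.zero]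
  length v hv := by
    have := hA.pos_add_le hv
    rw [hs _ (by omega), h.length v hv]
  get v hv j hj := by
    have := hA.pos_add_le hv
    rw [hs _ (by omega), h.get v hv j hj]

theorem Ready.setReg (h : Ready n A s) {r : ℕ} (hr : r = 0 ∨ 5 ≤ r) (x : ℕ) :
    Ready n A (s.setReg r x) where
  input := ⟨h.input.1, h.input.2, h.input.3⟩
  out := by rw [State.setReg_reg, if_neg (by omega), h.out]
  size := by rw [State.setReg_reg, if_neg (by omega), h.size]
  color := by rw [State.setReg_reg, if_neg (by omega), h.color]
  mark := by rw [State.setReg_reg, if_neg (by omega), h.mark]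

theorem Ready.setMem (h : Ready n A s) (hA : IsInput n A) {a : ℕ} (ha : n * n + 1 ≤ a) (x : ℕ) :
    Ready n A (s.setMem a x) where
  input := h.input.congr hA fun b hb => by rw [State.setMem_mem, if_neg (by omega)]
  out := h.out
  size := h.size
  color := h.color
  mark := h.mark

/-- Execute `P` for every vertex; register `5` holds the vertex and register `6` the address of
its entry in the input. -/
def forVertices (P : Program) : Program :=
  .seq (.assign 5 (.const 0)) (.seq (.assign 6 (.const 1))
    (.loop (.sub (.reg 2) (.reg 5)) (.seq P
      (.seq (.assign 6 (.add (.add (.reg 6) (.load (.reg 6))) (.const 1)))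
        (.assign 5 (.add (.reg 5) (.const 1)))))))

/-- Execute `P` for all elements of the list that stands in the memory from the address in
register `7` up to the address in register `8`; register `9` holds the current element. -/
def forList (P : Program) : Program :=
  .loop (.sub (.reg 8) (.reg 7)) (.seq (.assign 9 (.load (.reg 7)))
    (.seq P (.assign 7 (.add (.reg 7) (.const 1)))))

/-- A bound for the values that occur in the computation. -/
def Roomy (B n : ℕ) : Prop := 16 * (n * n) + 100 * n + 1000 ≤ B

/-- `hI` makes the invariant independent of the two loop registers, so that advancing them preserves
it. -/
theorem halts_forVertices {B : ℕ} (hA : IsInput n A) (hB : Roomy B n) {P : Program}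
    (I : ℕ → State → Prop) (T : ℕ → ℕ)
    (hI : ∀ v s x, I v s → I v (s.setReg 5 x) ∧ I v (s.setReg 6 x))
    (hP : ∀ v < n, ∀ s, Ready n A s → s.reg 5 = v → s.reg 6 = pos A v → I v s →
      Halts B P s (T v) fun s' => Ready n A s' ∧ s'.reg 5 = v ∧ s'.reg 6 = pos A v ∧ I (v + 1) s')
    (hs : Ready n A s) (h0 : I 0 s) :
    Halts B (forVertices P) s (∑ v ∈ Finset.range n, (T v + 20) + 20)
      fun s' => Ready n A s' ∧ I n s' := by
  unfold Roomy at hB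
  have hloop := halts_loop (B := B) (e := .sub (.reg 2) (.reg 5)) (P := .seq P
      (.seq (.assign 6 (.add (.add (.reg 6) (.load (.reg 6))) (.const 1)))
        (.assign 5 (.add (.reg 5) (.const 1)))))
    (fun v s => Ready n A s ∧ s.reg 5 = v ∧ s.reg 6 = pos A v ∧ I v s) (fun v => T v + 12) n
    (s := (s.setReg 5 0).setReg 6 1) ?_ ?_ ?_
  · refine halts_assign_seq (by simp [Expr.Fits]) (by simp [Expr.cost]) ?_
    refine halts_assign_seq (by simp [Expr.Fits]; omega) (by simp [Expr.cost]) ?_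
    refine hloop.mono ?_ fun s' h => ⟨h.1, h.2.2.2⟩
    simp only [Expr.cost, Finset.sum_add_distrib, Finset.sum_const, Finset.card_range, smul_eq_mul]
    omega
  · rintro v hv s ⟨hr, h5, h6, hi⟩
    refine ⟨?_, ?_, ?_⟩
    · simp only [Expr.Fits, h5, hr.size]; omega
    · simp only [Expr.eval, h5, hr.size]; omega
    refine Halts.seq ((hP v hv s hr h5 h6 hi).mono le_rfl ?_)
    rintro s' ⟨hr, h5, h6, hi⟩
    have hp := hA.pos_add_le hv
    have hd := hr.input.length v hv
    refine halts_assign_seq ?_ (by simp [Expr.cost]) (halts_assign ?_ (by simp [Expr.cost]) ?_)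
    · simp only [Expr.Fits, Expr.eval, h6, hd]; omega
    · simp [Expr.Fits, Expr.eval, h5]; omega
    · refine ⟨(hr.setReg (by omega) _).setReg (by omega) _, by simp [Expr.eval, h5], ?_,
        (hI _ _ _ (hI _ _ _ hi).2).1⟩
      simp [Expr.eval, h6, hd, pos_succ]
  · rintro s ⟨hr, h5, -, -⟩
    simp only [Expr.Fits, Expr.eval, h5, hr.size]; omega
  · exact ⟨(hs.setReg (by omega) _).setReg (by omega) _, by simp, by simp [pos],
      (hI _ _ _ (hI _ _ _ h0).1).2⟩

/-- Each vertex is charged in proportion to the length of its entry, and these lengths add up to the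
input length `pos A n`. -/
theorem halts_forVertices_of_linear {B : ℕ} (hA : IsInput n A) (hB : Roomy B n) {P : Program}
    (I : ℕ → State → Prop) (K : ℕ)
    (hI : ∀ v s x, I v s → I v (s.setReg 5 x) ∧ I v (s.setReg 6 x))
    (hP : ∀ v < n, ∀ s, Ready n A s → s.reg 5 = v → s.reg 6 = pos A v → I v s →
      Halts B P s (K * ((A v).length + 1))
        fun s' => Ready n A s' ∧ s'.reg 5 = v ∧ s'.reg 6 = pos A v ∧ I (v + 1) s')
    (hs : Ready n A s) (h0 : I 0 s) :
    Halts B (forVertices P) s ((K + 20) * pos A n) fun s' => Ready n A s' ∧ I n s' := by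
  refine (halts_forVertices hA hB I _ hI hP hs h0).mono ?_ fun _ h => h
  have : ∑ v ∈ Finset.range n, (K * ((A v).length + 1) + 20) ≤
      ∑ v ∈ Finset.range n, (K + 20) * ((A v).length + 1) :=
    Finset.sum_le_sum fun v _ => by nlinarith
  rw [← Finset.mul_sum] at this
  unfold pos
  nlinarith

/-- The list `L` of vertices stands at the address `a` within the input. -/
structure ListAt (n : ℕ) (A : ℕ → List ℕ) (a : ℕ) (L : List ℕ) : Prop where
  get : ∀ s, Ready n A s → ∀ (j : ℕ) (hj : j < L.length), s.mem (a + j) = L[j]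
  le : a + L.length ≤ n * n + 1
  lt : ∀ w ∈ L, w < n

theorem IsInput.listAt (hA : IsInput n A) {v : ℕ} (hv : v < n) :
    ListAt n A (pos A v + 1) (A v) where
  get s hs j hj := hs.input.get v hv j hj
  le := by have := hA.pos_add_le hv; omega
  lt := hA.lt v hv

theorem listAt_nil : ListAt n A 0 [] := ⟨by simp, by simp, by simp⟩

/-- The invariant is indexed by the prefix already read; that it is a prefix of `L` lets the body
bound its counters by `L.length`. -/
theorem halts_forList {B a : ℕ} {L : List ℕ} (hB : Roomy B n) (hL : ListAt n A a L) {P : Program}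
    (I : List ℕ → State → Prop) (T : ℕ)
    (hI : ∀ l s x, I l s → I l (s.setReg 7 x) ∧ I l (s.setReg 9 x))
    (hP : ∀ l w, w < n → l <+: L → w ∈ L → ∀ s, Ready n A s → s.reg 9 = w → I l s →
      Halts B P s T fun s' => Ready n A s' ∧ s'.reg 7 = s.reg 7 ∧ s'.reg 8 = s.reg 8 ∧
        I (l ++ [w]) s')
    (hs : Ready n A s) (h7 : s.reg 7 = a) (h8 : s.reg 8 = a + L.length) (h0 : I [] s) :
    Halts B (forList P) s ((T + 20) * L.length + 20) fun s' => Ready n A s' ∧ I L s' := by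
  unfold Roomy at hB
  have hle := hL.le
  refine (halts_loop (fun j s => Ready n A s ∧ s.reg 7 = a + j ∧ s.reg 8 = a + L.length ∧
    I (L.take j) s) (fun _ => 3 + (T + 4)) L.length ?_ ?_ ?_).mono ?_ ?_
  · rintro j hj s ⟨hr, h7, h8, hi⟩
    have hm := hL.get s hr j hj
    have hlt := hL.lt _ (List.getElem_mem hj)
    have hn := Nat.le_mul_self n
    refine ⟨?_, ?_, ?_⟩
    · simp only [Expr.Fits, h7, h8]; omega
    · simp only [Expr.eval, h7, h8]; omega
    refine Halts.seq (halts_assign ?_ (by simp [Expr.cost]) ?_)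
    · simp only [Expr.Fits, Expr.eval, h7, hm]; omega
    refine Halts.seq ((hP (L.take j) L[j] hlt (List.take_prefix _ _) (List.getElem_mem hj) _
      (hr.setReg (by omega) _) (by simp [Expr.eval, h7, hm]) (hI _ _ _ hi).2).mono le_rfl ?_)
    rintro s' ⟨hr', h7', h8', hi'⟩
    simp only [State.setReg_reg, h7, h8, Nat.reduceEqDiff, if_false]
      at h7' h8'
    refine halts_assign ?_ (by simp [Expr.cost]) ?_
    · simp only [Expr.Fits, Expr.eval, h7']; omega
    · refine ⟨hr'.setReg (by omega) _, by simp [Expr.eval, h7', add_assoc], by simp [h8'], ?_⟩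
      rw [List.take_succ_eq_append_getElem hj]
      exact (hI _ _ _ hi').1
  · rintro s ⟨hr, h7, h8, -⟩
    simp only [Expr.Fits, Expr.eval, h7, h8]; omega
  · exact ⟨hs, by simpa using h7, h8, by simpa using h0⟩
  · simp only [Expr.cost, Finset.sum_const, Finset.card_range, smul_eq_mul]
    rw [Nat.mul_comm L.length]
    nlinarith
  · rintro s ⟨hr, -, -, hi⟩
    exact ⟨hr, by simpa using hi⟩

end RAM

/-! ### The check of a coloring -/

namespace RAM

variable {n : ℕ} {A : ℕ → List ℕ} {col : ℕ → ℕ} {s : State} {B : ℕ}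

/-- The number of vertices with color `c`. -/
def classSize (n : ℕ) (col : ℕ → ℕ) (c : ℕ) : ℕ := ((Finset.range n).filter (col · = c)).card

/-- The neighbors of `v` with another color. -/
def cross (A : ℕ → List ℕ) (col : ℕ → ℕ) (v : ℕ) : List ℕ := (A v).filter (col · ≠ col v)

/-- The vertex `v` has at most two neighbors with another color, and sufficiently many with its
own. -/
def VertexOk (n : ℕ) (A : ℕ → List ℕ) (col : ℕ → ℕ) (v : ℕ) : Prop :=
  (cross A col v).length ≤ 2 ∧
    (cross A col v).length + classSize n col (col v) ≤ (A v).length + 1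

/-- An injective code for unordered pairs. -/
def pairCode (v x : ℕ) : ℕ := (v + x) * (v + x) + ((v - x) + (x - v))

/-- The colors of the vertices stand in the memory. -/
def ColorsAt (n : ℕ) (col : ℕ → ℕ) (s : State) : Prop := ∀ v < n, s.mem (n * n + 1 + v) = col v

/-- The edges of the root graph that belong to the first `k` vertices stand in the memory. -/
def EdgesAt (n : ℕ) (A : ℕ → List ℕ) (col : ℕ → ℕ) (k : ℕ) (s : State) : Prop :=
  ∀ v < k, ∃ x y l, (cross A col v).reverse ++ [n, n + 1] = x :: y :: l ∧
    s.mem (n * n + 2 * n + 14 + 3 * v) = pairCode v x ∧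
    s.mem (n * n + 2 * n + 15 + 3 * v) = pairCode v y ∧
    s.mem (n * n + 2 * n + 16 + 3 * v) = col v

theorem sum_le_of_le_one (hc : ∀ v, col v ≤ 1) (k : ℕ) : ∑ u ∈ Finset.range k, col u ≤ k := by
  simpa using Finset.sum_le_card_nsmul (Finset.range k) col 1 fun v _ => hc v

/-- This closed form is what the program evaluates: the sum of the colors counts the vertices of
color 1. -/
theorem classSize_eq (hc : ∀ v, col v ≤ 1) (c : ℕ) (h : c ≤ 1) :
    classSize n col c = c * (∑ u ∈ Finset.range n, col u) +
      (1 - c) * (n - ∑ u ∈ Finset.range n, col u) := by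
  have h1 : classSize n col 1 = ∑ u ∈ Finset.range n, col u := by
    rw [classSize, Finset.card_filter]
    refine Finset.sum_congr rfl fun u _ => ?_
    have := hc u
    split_ifs <;> omega
  have h0 : classSize n col 0 + classSize n col 1 = n := by
    have h2 : (Finset.range n).filter (col · = 1) = (Finset.range n).filter (¬ col · = 0) := by
      ext u
      have := hc u
      rw [Finset.mem_filter, Finset.mem_filter]
      exact and_congr_right fun _ => by omega
    rw [classSize, classSize, h2, Finset.card_filter_add_card_filter_not, Finset.card_range]
  obtain rfl | rfl : c = 0 ∨ c = 1 := by omega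
  all_goals simp only [zero_mul, one_mul, Nat.sub_self, Nat.sub_zero]; omega

/-- Count the vertices of color `1` in register `11`. -/
def countOnes : Program :=
  .seq (.assign 11 (.const 0))
    (forVertices (.assign 11 (.add (.reg 11) (.load (.add (.reg 3) (.reg 5))))))

theorem halts_countOnes (hA : IsInput n A) (hB : Roomy B n) (hc : ∀ v, col v ≤ 1)
    (hs : Ready n A s) (hcol : ColorsAt n col s) :
    Halts B countOnes s (40 * pos A n) fun s' => Ready n A s' ∧ ColorsAt n col s' ∧
      s'.reg 0 = s.reg 0 ∧ s'.reg 11 = ∑ u ∈ Finset.range n, col u := by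
  have hn := Nat.le_mul_self n
  refine (Halts.seq (T := 2) (halts_assign (by simp [Expr.Fits]) (by simp [Expr.cost])
    (halts_forVertices_of_linear hA hB (fun v s' => ColorsAt n col s' ∧ s'.reg 0 = s.reg 0 ∧
      s'.reg 11 = ∑ u ∈ Finset.range v, col u) 10 ?_ ?_ (hs.setReg (by omega) _)
      ⟨hcol, by simp, by simp [Expr.eval]⟩))).mono ?_ fun _ h => h
  · rintro v s x ⟨h1, h2, h3⟩
    exact ⟨⟨h1, by simpa, by simpa⟩, ⟨h1, by simpa, by simpa⟩⟩
  · rintro v hv s hr h5 h6 ⟨h1, h2, h3⟩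
    have h4 := h1 v hv
    have h7 := sum_le_of_le_one hc v
    have h8 := hc v
    unfold Roomy at hB
    refine halts_assign ?_ (by simp [Expr.cost]; omega) ⟨hr.setReg (by omega) _, by simpa,
      by simpa, h1, by simpa, ?_⟩
    · simp only [Expr.Fits, Expr.eval, h5, hr.color, h4, h3]; omega
    · simp [Expr.eval, h5, hr.color, h4, h3, Finset.sum_range_succ]
  · have : 1 ≤ pos A n := by unfold pos; omega
    omega

/-- Collect the neighbors of the current vertex that have another color: their number in register
`10`, the last two of them in the registers `12` and `13`. -/
def collectCross : Program :=
  .seq (.assign 10 (.const 0)) <| .seq (.assign 12 (.reg 2)) <|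
  .seq (.assign 13 (.add (.reg 2) (.const 1))) <|
  .seq (.assign 14 (.load (.add (.reg 3) (.reg 5)))) <|
  .seq (.assign 7 (.add (.reg 6) (.const 1))) <|
  .seq (.assign 8 (.add (.reg 7) (.load (.reg 6)))) <|
  forList <| .branch (.add (.sub (.load (.add (.reg 3) (.reg 9))) (.reg 14))
      (.sub (.reg 14) (.load (.add (.reg 3) (.reg 9)))))
    (.seq (.assign 10 (.add (.reg 10) (.const 1)))
      (.seq (.assign 13 (.reg 12)) (.assign 12 (.reg 9)))) .nop

theorem cons_cons_le {n x y : ℕ} {l l' : List ℕ} (hl : ∀ w ∈ l, w < n)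
    (h : l.reverse ++ [n, n + 1] = x :: y :: l') : x ≤ n + 1 ∧ y ≤ n + 1 := by
  have h' : ∀ z ∈ l.reverse ++ [n, n + 1], z ≤ n + 1 := by
    intro z hz
    simp only [List.mem_append, List.mem_reverse, List.mem_cons, List.not_mem_nil, or_false] at hz
    rcases hz with hz | rfl | rfl
    · have := hl z hz; omega
    · omega
    · omega
  rw [h] at h'
  exact ⟨h' _ (by simp), h' _ (by simp)⟩

/-- Registers 12 and 13 act as the top of a stack that starts as `[n, n + 1]` and onto which every
neighbor of the other color is pushed. Fewer than two such neighbors thus leave padding in place. -/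
theorem halts_collectCross (hA : IsInput n A) (hB : Roomy B n) (hc : ∀ v, col v ≤ 1)
    {v : ℕ} (hv : v < n) (hs : Ready n A s) (h5 : s.reg 5 = v) (h6 : s.reg 6 = pos A v)
    (hcol : ColorsAt n col s) :
    Halts B collectCross s (100 * ((A v).length + 1)) fun s' => Ready n A s' ∧
      s'.mem = s.mem ∧ s'.reg 0 = s.reg 0 ∧ s'.reg 11 = s.reg 11 ∧ s'.reg 5 = v ∧
      s'.reg 6 = pos A v ∧ s'.reg 14 = col v ∧ s'.reg 10 = (cross A col v).length ∧
      ∃ l, (cross A col v).reverse ++ [n, n + 1] = s'.reg 12 :: s'.reg 13 :: l := by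
  have hn := Nat.le_mul_self n
  have hp := hA.pos_add_le hv
  have hd := hs.input.length v hv
  have hcv := hcol v hv
  have hc1 := hc v
  have hR := hB
  unfold Roomy at hB
  refine (Halts.seq (T' := 60 + ((50 + 20) * (A v).length + 20)) (halts_assign
    (by simp [Expr.Fits]) le_rfl ?_)).mono
    (by simp only [Expr.cost]; omega) fun _ h => h
  refine halts_assign_seq (by simp [Expr.Fits, Expr.eval, hs.size]; omega)
    (by simp [Expr.cost]; omega) ?_
  refine halts_assign_seq (by simp [Expr.Fits, Expr.eval, hs.size]; omega)
    (by simp [Expr.cost]; omega) ?_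
  refine halts_assign_seq (by simp [Expr.Fits, Expr.eval, hs.color, h5, hcv]; omega)
    (by simp [Expr.cost]; omega) ?_
  refine halts_assign_seq (by simp [Expr.Fits, Expr.eval, h6]; omega)
    (by simp [Expr.cost]; omega) ?_
  refine halts_assign_seq (by simp [Expr.Fits, Expr.eval, h6, hd]; omega)
    (by simp [Expr.cost]; omega) ?_
  refine (halts_forList hR (hA.listAt hv) (fun l s' => s'.mem = s.mem ∧ s'.reg 0 = s.reg 0 ∧
      s'.reg 11 = s.reg 11 ∧ s'.reg 5 = v ∧
      s'.reg 6 = pos A v ∧ s'.reg 14 = col v ∧ s'.reg 10 = (l.filter (col · ≠ col v)).length ∧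
      ∃ l', (l.filter (col · ≠ col v)).reverse ++ [n, n + 1] = s'.reg 12 :: s'.reg 13 :: l') 50
      ?_ ?_ ?_ ?_ ?_ ?_).mono ?_ fun _ h => h
  · rintro l s x ⟨h1, h2, h3, h4, h5, h6, h7, h8⟩
    constructor <;> exact ⟨h1, by simpa, by simpa, by simpa, by simpa, by simpa,
      by simpa using h7, by simpa using h8⟩
  · rintro l w hw hl hwA t ht h9 ⟨h1, h2, h3, h4, h5, h6, h7, l', h8⟩
    have hcw := hcol w hw
    rw [← h1] at hcw
    have hcw1 := hc w
    have hlen := hl.length_le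
    have hfl := List.length_filter_le (col · ≠ col v) l
    have hlt := hA.length_lt v hv
    have hlt' : ∀ z ∈ l.filter (col · ≠ col v), z < n := fun z hz =>
      hA.lt v hv z (hl.subset (List.mem_of_mem_filter hz))
    have hxy := cons_cons_le hlt' h8
    refine halts_branch ?_ (by simp [Expr.cost]) ?_ ?_
    · simp only [Expr.Fits, Expr.eval, ht.color, h9, h6, hcw]; omega
    · simp only [Expr.eval, ht.color, h9, h6, hcw]
      intro hne
      -- The two truncated differences tested by the branch add up to |col w - col v|.
      have hne : col w ≠ col v := by omega
      refine halts_assign_seq (by simp only [Expr.Fits, Expr.eval, h7]; omega)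
        (by simp [Expr.cost]) ?_
      refine halts_assign_seq (by simp [Expr.Fits]; omega) (by simp [Expr.cost]) ?_
      refine halts_assign (by simp [Expr.Fits, h9]; omega) (by simp [Expr.cost]) ?_
      refine ⟨((ht.setReg (by omega) _).setReg (by omega) _).setReg (by omega) _, by simp,
        by simp, h1, by simpa, by simpa, by simpa, by simpa, by simpa, ?_, t.reg 13 :: l', ?_⟩
      · simpa [List.filter_append, hne, Expr.eval] using h7
      · simpa [List.filter_append, hne, Expr.eval, h9] using h8
    · simp only [Expr.eval, ht.color, h9, h6, hcw]
      intro heq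
      have heq : col w = col v := by omega
      refine halts_nop (by simp [Expr.cost]) ⟨ht, rfl, rfl, h1, h2, h3, h4, h5, h6, ?_, l', ?_⟩
      · simpa [List.filter_append, heq] using h7
      · simpa [List.filter_append, heq] using h8
  · exact (((((hs.setReg (by omega) _).setReg (by omega) _).setReg (by omega) _).setReg
      (by omega) _).setReg (by omega) _).setReg (by omega) _
  · simp [Expr.eval, h6]
  · simp [Expr.eval, h6, hd]
  · simp [Expr.eval, h5, h6, hs.color, hs.size, hcv]
  · simp [Expr.cost]; omega

/-- The code of the pair of the current vertex and the content of register `r`. -/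
def codeExpr (r : ℕ) : Expr :=
  .add (.mul (.add (.reg 5) (.reg r)) (.add (.reg 5) (.reg r)))
    (.add (.sub (.reg 5) (.reg r)) (.sub (.reg r) (.reg 5)))

/-- The address of the `i`-th entry of the current vertex in the output. -/
def outExpr (i : ℕ) : Expr := .add (.reg 1) (.add (.mul (.const 3) (.reg 5)) (.const i))

/-- Write down the edge of the current vertex, and set register `0` to `0` if the vertex violates
the condition `VertexOk`. -/
def checkVertex : Program :=
  .seq collectCross <| .seq (.store (outExpr 1) (codeExpr 12)) <|
  .seq (.store (outExpr 2) (codeExpr 13)) <| .seq (.store (outExpr 3) (.reg 14)) <|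
  .branch (.add (.sub (.reg 10) (.const 2))
      (.sub (.add (.reg 10) (.add (.mul (.reg 14) (.reg 11))
          (.mul (.sub (.const 1) (.reg 14)) (.sub (.reg 2) (.reg 11)))))
        (.add (.load (.reg 6)) (.const 1))))
    (.assign 0 (.const 0)) .nop

/-- Decide whether the coloring in the memory satisfies the condition `VertexOk` everywhere, and
write down the root graph that belongs to it. -/
def check : Program :=
  .seq (.assign 0 (.const 1)) <| .seq countOnes <|
  .seq (.store (.reg 1) (.add (.mul (.const 4) (.mul (.reg 2) (.reg 2)))
    (.add (.mul (.const 2) (.reg 2)) (.const 1)))) <|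
  forVertices checkVertex

/-- Register `0` tells whether the first `k` vertices satisfy the condition `VertexOk`. -/
def Verdict (n : ℕ) (A : ℕ → List ℕ) (col : ℕ → ℕ) (k : ℕ) (s : State) : Prop :=
  (s.reg 0 = 1 ∧ ∀ u < k, VertexOk n A col u) ∨ (s.reg 0 = 0 ∧ ∃ u < k, ¬ VertexOk n A col u)

/-- The root graph stands in the memory. -/
structure RootAt (n : ℕ) (A : ℕ → List ℕ) (col : ℕ → ℕ) (k : ℕ) (s : State) : Prop where
  card : s.mem (n * n + 2 * n + 13) = 4 * (n * n) + 2 * n + 1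
  edges : EdgesAt n A col k s

/-- Since v + x ≤ 2n, the square is at most 4n² and the difference at most 2n. This is the origin of
the number 4n² + 2n + 1 of root vertices. -/
theorem pairCode_le {v x : ℕ} (hv : v < n) (hx : x ≤ n + 1) :
    pairCode v x ≤ 4 * (n * n) + 2 * n := by
  have := Nat.mul_le_mul (show v + x ≤ 2 * n by omega) (show v + x ≤ 2 * n by omega)
  have : (2 * n) * (2 * n) = 4 * (n * n) := by ring
  unfold pairCode
  omega

theorem fits_codeExpr (hB : Roomy B n) {r v : ℕ} (h5 : s.reg 5 = v) (hv : v < n)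
    (hx : s.reg r ≤ n + 1) : (codeExpr r).Fits B s := by
  have := pairCode_le hv hx
  unfold Roomy at hB
  unfold pairCode at this
  simp only [codeExpr, Expr.Fits, Expr.eval, h5]
  omega

theorem fits_outExpr (hB : Roomy B n) (hs : Ready n A s) {i v : ℕ} (hi : i ≤ 3)
    (h5 : s.reg 5 = v) (hv : v < n) : (outExpr i).Fits B s := by
  unfold Roomy at hB
  simp only [outExpr, Expr.Fits, Expr.eval, h5, hs.out]
  omega

theorem eval_codeExpr {r v : ℕ} (h5 : s.reg 5 = v) :
    (codeExpr r).eval s = pairCode v (s.reg r) := by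
  simp only [codeExpr, Expr.eval, h5, pairCode]

theorem eval_outExpr (hs : Ready n A s) {i v : ℕ} (h5 : s.reg 5 = v) :
    (outExpr i).eval s = n * n + 2 * n + (13 + i) + 3 * v := by
  simp only [outExpr, Expr.eval, h5, hs.out]
  omega

theorem halts_checkVertex (hA : IsInput n A) (hB : Roomy B n) (hc : ∀ v, col v ≤ 1)
    {v : ℕ} (hv : v < n) (hs : Ready n A s) (h5 : s.reg 5 = v) (h6 : s.reg 6 = pos A v)
    (hcol : ColorsAt n col s) (h11 : s.reg 11 = ∑ u ∈ Finset.range n, col u)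
    (hroot : RootAt n A col v s) (hverdict : Verdict n A col v s) :
    Halts B checkVertex s (200 * ((A v).length + 1)) fun s' => Ready n A s' ∧
      s'.reg 5 = v ∧ s'.reg 6 = pos A v ∧ ColorsAt n col s' ∧
      s'.reg 11 = ∑ u ∈ Finset.range n, col u ∧ RootAt n A col (v + 1) s' ∧
      Verdict n A col (v + 1) s' := by
  refine (Halts.seq (T' := 100) ((halts_collectCross hA hB hc hv hs h5 h6 hcol).mono le_rfl
    ?_)).mono (by omega) fun _ h => h
  rintro t ⟨ht, htm, h0, h11', h5, h6, h14, h10, l, hl⟩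
  obtain ⟨hx, hy⟩ := cons_cons_le (fun w hw => hA.lt v hv w (List.mem_of_mem_filter hw)) hl
  have hR := hB
  unfold Roomy at hB
  have hc1 := hc v
  refine halts_store_seq ⟨fits_outExpr hR ht (by omega) h5 hv, fits_codeExpr hR h5 hv hx⟩
    (eval_outExpr ht h5) (eval_codeExpr h5) (by simp [Expr.cost, outExpr, codeExpr]) ?_
  have ht1 := ht.setMem hA (a := n * n + 2 * n + (13 + 1) + 3 * v) (by omega)
    (pairCode v (t.reg 12))
  refine halts_store_seq ⟨fits_outExpr hR ht1 (by omega) h5 hv, fits_codeExpr hR h5 hv hy⟩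
    (x := pairCode v (t.reg 13)) (eval_outExpr ht1 h5) (eval_codeExpr h5)
    (by simp [Expr.cost, outExpr, codeExpr]) ?_
  have ht2 := ht1.setMem hA (a := n * n + 2 * n + (13 + 2) + 3 * v) (by omega)
    (pairCode v (t.reg 13))
  refine halts_store_seq ⟨fits_outExpr hR ht2 (by omega) h5 hv, by simp [Expr.Fits, h14]; omega⟩
    (eval_outExpr ht2 h5) h14 (by simp [Expr.cost, outExpr, codeExpr]) ?_
  have ht3 := ht2.setMem hA (a := n * n + 2 * n + (13 + 3) + 3 * v) (by omega) (col v)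
  have hmem : ∀ a, State.mem (((t.setMem (n * n + 2 * n + (13 + 1) + 3 * v)
      (pairCode v (t.reg 12))).setMem (n * n + 2 * n + (13 + 2) + 3 * v)
      (pairCode v (t.reg 13))).setMem (n * n + 2 * n + (13 + 3) + 3 * v) (col v)) a =
      if a = n * n + 2 * n + 16 + 3 * v then col v else
      if a = n * n + 2 * n + 15 + 3 * v then pairCode v (t.reg 13) else
      if a = n * n + 2 * n + 14 + 3 * v then pairCode v (t.reg 12) else s.mem a := by
    intro a
    simp only [State.setMem_mem, htm]
  generalize ht' : State.setMem (State.setMem (State.setMem _ _ _) _ _) _ _ = t' at ht3 hmem ⊢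
  have hreg : t'.reg = t.reg := by rw [← ht']; rfl
  rw [← hreg] at h0 h11' h5 h6 h14 h10 hl
  clear ht'
  have hcol' : ColorsAt n col t' := by
    intro u hu
    rw [hmem, if_neg (by omega), if_neg (by omega), if_neg (by omega), hcol u hu]
  have hroot' : RootAt n A col (v + 1) t' := by
    constructor
    · rw [hmem, if_neg (by omega), if_neg (by omega), if_neg (by omega), hroot.card]
    · intro u hu
      obtain rfl | hu : u = v ∨ u < v := by omega
      · refine ⟨_, _, l, hl, ?_, ?_, ?_⟩
        · rw [hmem, if_neg (by omega), if_neg (by omega), if_pos rfl, hreg]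
        · rw [hmem, if_neg (by omega), if_pos rfl, hreg]
        · rw [hmem, if_pos rfl]
      · obtain ⟨x, y, l', h1, h2, h3, h4⟩ := hroot.edges u hu
        refine ⟨x, y, l', h1, ?_, ?_, ?_⟩
        all_goals rwa [hmem, if_neg (by omega), if_neg (by omega), if_neg (by omega)]
  have hS := sum_le_of_le_one hc n
  have hsize := classSize_eq (n := n) hc (col v) (hc v)
  have hlen := hA.length_lt v hv
  have hfl := List.length_filter_le (col · ≠ col v) (A v)
  change (cross A col v).length ≤ _ at hfl
  have hd := ht3.input.length v hv
  rw [h11] at h11'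
  have hp := hA.pos_add_le hv
  have hcs : classSize n col (col v) ≤ n :=
    (Finset.card_filter_le _ _).trans (Finset.card_range n).le
  -- The tested sum of truncated differences vanishes exactly when both inequalities of `VertexOk`
  -- hold.
  refine halts_branch ?_ (by simp [Expr.cost, outExpr, codeExpr]) ?_ ?_
  · simp only [Expr.Fits, Expr.eval, h10, h14, h11', ht3.size, h6, hd, ← hsize]
    have h1 : col v * (∑ u ∈ Finset.range n, col u) ≤ n := by omega
    have h2 : (1 - col v) * (n - ∑ u ∈ Finset.range n, col u) ≤ n := by omega
    omega
  · simp only [Expr.eval, h10, h14, h11', ht3.size, h6, hd, ← hsize]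
    intro hne
    refine halts_assign (by simp [Expr.Fits]) (by simp [Expr.cost, outExpr, codeExpr])
      ⟨ht3.setReg (by omega) _, by simpa, by simpa, hcol', by simpa, ⟨hroot'.1, hroot'.2⟩, .inr
        ⟨by simp [Expr.eval], v, by omega, ?_⟩⟩
    unfold VertexOk
    omega
  · simp only [Expr.eval, h10, h14, h11', ht3.size, h6, hd, ← hsize]
    intro heq
    refine halts_nop (by simp [Expr.cost, outExpr, codeExpr])
      ⟨ht3, h5, h6, hcol', h11', hroot', ?_⟩
    unfold Verdict
    rw [h0]
    refine hverdict.imp (And.imp_right fun h u hu => ?_) (And.imp_right fun ⟨u, hu, h⟩ =>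
      ⟨u, by omega, h⟩)
    obtain rfl | hu : u = v ∨ u < v := by omega
    · unfold VertexOk; omega
    · exact h u hu

theorem halts_check (hA : IsInput n A) (hB : Roomy B n) (hc : ∀ v, col v ≤ 1)
    (hs : Ready n A s) (hcol : ColorsAt n col s) :
    Halts B check s (400 * pos A n) fun s' => Ready n A s' ∧ ColorsAt n col s' ∧
      RootAt n A col n s' ∧ Verdict n A col n s' := by
  have hR := hB
  unfold Roomy at hB
  have hp : 1 ≤ pos A n := by unfold pos; omega
  refine (Halts.seq (T := 2) (T' := 40 * pos A n + (20 + 220 * pos A n)) (halts_assign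
    (by simp [Expr.Fits]; omega) (by simp [Expr.cost])
    (Halts.seq ((halts_countOnes hA hR hc (hs.setReg (by omega) _) hcol).mono le_rfl ?_)))).mono
    (by omega) fun _ h => h
  rintro t ⟨ht, hcol, h0, h11⟩
  have hn := Nat.le_mul_self n
  refine Halts.seq (halts_store (a := n * n + 2 * n + 13) (x := 4 * (n * n) + 2 * n + 1) ⟨?_, ?_⟩
    ht.out (by simp only [Expr.eval, ht.size, add_assoc]) (by simp [Expr.cost]) ?_)
  · simp only [Expr.Fits, ht.out]; omega
  · simp only [Expr.Fits, Expr.eval, ht.size]; omega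
  refine (halts_forVertices_of_linear hA hR (fun v s' => ColorsAt n col s' ∧
      s'.reg 11 = ∑ u ∈ Finset.range n, col u ∧ RootAt n A col v s' ∧ Verdict n A col v s') 200
    ?_ ?_ ?_ ?_).mono le_rfl fun s' h => ⟨h.1, h.2.1, h.2.2.2⟩
  · rintro v s x ⟨h1, h2, h3, h4⟩
    constructor <;> exact ⟨h1, by simpa, ⟨h3.1, h3.2⟩, by simpa [Verdict] using h4⟩
  · rintro v hv s hs h5 h6 ⟨h1, h2, h3, h4⟩
    exact halts_checkVertex hA hR hc hv hs h5 h6 h1 h2 h3 h4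
  · exact ht.setMem hA (by omega) _
  · refine ⟨fun u hu => ?_, h11, ⟨?_, fun u hu => absurd hu (by omega)⟩, .inl ⟨?_, fun u hu =>
      absurd hu (by omega)⟩⟩
    · rw [State.setMem_mem, if_neg (by omega), hcol u hu]
    · rw [State.setMem_mem, if_pos rfl]
    · simpa [Expr.eval] using h0

end RAM

/-! ### The search for a coloring -/

namespace RAM

variable {n : ℕ} {A : ℕ → List ℕ} {col : ℕ → ℕ} {s : State} {B : ℕ} {L : List ℕ}

/-- Load the number of vertices and choose the addresses of the arrays. -/
def setup : Program :=
  .seq (.assign 2 (.load (.const 0))) <|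
  .seq (.assign 3 (.add (.mul (.reg 2) (.reg 2)) (.const 1))) <|
  .seq (.assign 4 (.add (.add (.reg 3) (.reg 2)) (.const 12))) <|
  .assign 1 (.add (.reg 4) (.reg 2))

/-- The input fits below n² + 1, so the arrays start there and no address depends on the number of
edges. The 12 extra cells after the colors keep the exhaustive search on vertices 0, …, 11 away from
marks and output even when n < 12. -/
theorem halts_setup (hB : Roomy B n) (hs : InputAt n A s) (hreg : ∀ r, s.reg r = 0) :
    Halts B setup s 40 fun s' => Ready n A s' ∧ s'.mem = s.mem ∧ s'.reg 7 = 0 ∧ s'.reg 8 = 0 := by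
  have h0 := hs.zero
  unfold Roomy at hB
  have hn := Nat.le_mul_self n
  refine halts_assign_seq (by simp [Expr.Fits, Expr.eval, h0]; omega) (by simp [Expr.cost]) ?_
  refine halts_assign_seq (by simp [Expr.Fits, Expr.eval, h0]; omega) (by simp [Expr.cost]) ?_
  refine halts_assign_seq (by simp [Expr.Fits, Expr.eval, h0]; omega) (by simp [Expr.cost]) ?_
  refine halts_assign (by simp [Expr.Fits, Expr.eval, h0]; omega) (by simp [Expr.cost]) ?_
  refine ⟨⟨⟨hs.1, hs.2, hs.3⟩, ?_, ?_, ?_, ?_⟩, rfl, by simp [hreg], by simp [hreg]⟩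
  · simp [Expr.eval, h0]; omega
  · simp [Expr.eval, h0]
  · simp [Expr.eval, h0]
  · simp [Expr.eval, h0]; omega

/-- `L` is the list of the neighbors of a vertex with at least five non-neighbors, or it is empty
and there is no such vertex among the first `k` ones. -/
def IsPivot (n : ℕ) (A : ℕ → List ℕ) (k : ℕ) (L : List ℕ) : Prop :=
  (∃ v < k, L = A v ∧ L.length + 6 ≤ n) ∨ (L = [] ∧ ∀ v < k, n < (A v).length + 6)

/-- Let the registers `7` and `8` delimit the neighbors of a vertex with at least five
non-neighbors, if there is one. -/
def findPivot : Program :=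
  forVertices (.branch (.sub (.add (.reg 2) (.const 1)) (.add (.load (.reg 6)) (.const 6)))
    (.seq (.assign 7 (.add (.reg 6) (.const 1))) (.assign 8 (.add (.reg 7) (.load (.reg 6)))))
    .nop)

/-- The last suitable vertex is kept; if there is none, the initial zeros in registers 7 and 8
delimit the empty list. -/
theorem halts_findPivot (hA : IsInput n A) (hB : Roomy B n) (hs : Ready n A s)
    (h7 : s.reg 7 = 0) (h8 : s.reg 8 = 0) :
    Halts B findPivot s (50 * pos A n) fun s' => Ready n A s' ∧ s'.mem = s.mem ∧
      ∃ L, ListAt n A (s'.reg 7) L ∧ s'.reg 8 = s'.reg 7 + L.length ∧ IsPivot n A n L := by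
  have hR := hB
  unfold Roomy at hB
  refine halts_forVertices_of_linear hA hR (fun v s' => s'.mem = s.mem ∧
      ∃ L, ListAt n A (s'.reg 7) L ∧ s'.reg 8 = s'.reg 7 + L.length ∧ IsPivot n A v L) 30
    ?_ ?_ hs ⟨rfl, [], by rw [h7]; exact listAt_nil, by simp [h7, h8], .inr ⟨rfl, by simp⟩⟩
  · rintro v s x ⟨h1, L, h2, h3, h4⟩
    constructor <;> exact ⟨h1, L, by simpa, by simpa, h4⟩
  · rintro v hv t ht h5 h6 ⟨h1, L, h2, h3, h4⟩
    have hd := ht.input.length v hv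
    have hp := hA.pos_add_le hv
    have hl := hA.length_lt v hv
    have hn := Nat.le_mul_self n
    refine halts_branch ?_ (by simp [Expr.cost]; omega) ?_ ?_
    · simp only [Expr.Fits, Expr.eval, ht.size, h6, hd]; omega
    · simp only [Expr.eval, ht.size, h6, hd]
      intro hne
      refine halts_assign_seq (by simp [Expr.Fits, Expr.eval, h6]; omega)
        (by simp [Expr.cost]; omega) ?_
      refine halts_assign (by simp [Expr.Fits, Expr.eval, h6, hd]; omega)
        (by simp [Expr.cost]; omega) ?_
      refine ⟨(ht.setReg (by omega) _).setReg (by omega) _, by simpa, by simpa, h1, A v, ?_, ?_,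
        .inl ⟨v, by omega, rfl, by omega⟩⟩
      · simpa [Expr.eval, h6] using hA.listAt hv
      · simp [Expr.eval, h6, hd]
    · simp only [Expr.eval, ht.size, h6, hd]
      intro heq
      refine halts_nop (by simp [Expr.cost]; omega) ⟨ht, h5, h6, h1, L, h2, h3, h4.imp ?_ ?_⟩
      · exact fun ⟨u, hu, h⟩ => ⟨u, by omega, h⟩
      · refine fun ⟨h, h'⟩ => ⟨h, fun u hu => ?_⟩
        obtain rfl | hu : u = v ∨ u < v := by omega
        · omega
        · exact h' u hu

/-- Mark the vertices of the list delimited by the registers `7` and `8`. -/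
def markList : Program := forList (.store (.add (.reg 4) (.reg 9)) (.const 1))

/-- The vertices of `L`, and no others, are marked in the memory. -/
def MarksAt (n : ℕ) (L : List ℕ) (s : State) : Prop :=
  ∀ w < n, s.mem (n * n + n + 13 + w) = if w ∈ L then 1 else 0

/-- Memory beyond the input is still zero at this stage, so the mark array needs no clearing. -/
theorem halts_markList (hA : IsInput n A) (hB : Roomy B n) (hs : Ready n A s)
    (hL : ListAt n A (s.reg 7) L) (h8 : s.reg 8 = s.reg 7 + L.length)
    (hmem : ∀ a ≥ n * n + 1, s.mem a = 0) :
    Halts B markList s (30 * L.length + 20) fun s' => Ready n A s' ∧ MarksAt n L s' := by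
  have hR := hB
  unfold Roomy at hB
  refine halts_forList hR hL (fun l s' => MarksAt n l s') 10 ?_ ?_ hs rfl h8 ?_
  · exact fun l s x h => ⟨h, h⟩
  · intro l w hw hl hwL t ht h9 h
    refine halts_store (a := n * n + n + 13 + w) (x := 1) ⟨?_, ?_⟩ ?_ rfl (by simp [Expr.cost])
      ⟨ht.setMem hA (by omega) _, rfl, rfl, ?_⟩
    · simp only [Expr.Fits, Expr.eval, ht.mark, h9]; omega
    · simp only [Expr.Fits]; omega
    · simp only [Expr.eval, ht.mark, h9]
    · intro u hu
      rw [State.setMem_mem]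
      by_cases huw : u = w
      · simp [huw]
      · rw [if_neg (by omega), h u hu]
        simp [huw]
  · intro w hw
    rw [hmem _ (by omega)]
    simp

/-- The color of `u` is `1` if at least four neighbors of `u` are not in `L`. -/
def guess (A : ℕ → List ℕ) (L : List ℕ) (u : ℕ) : ℕ :=
  1 - (4 - ((A u).filter (· ∉ L)).length)

theorem guess_le_one (u : ℕ) : guess A L u ≤ 1 := by unfold guess; omega

/-- Color the vertices by `guess`. -/
def colorByGuess : Program :=
  forVertices <| .seq (.assign 10 (.const 0)) <|
  .seq (.assign 7 (.add (.reg 6) (.const 1))) <|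
  .seq (.assign 8 (.add (.reg 7) (.load (.reg 6)))) <|
  .seq (forList (.assign 10 (.add (.reg 10)
    (.sub (.const 1) (.load (.add (.reg 4) (.reg 9))))))) <|
  .store (.add (.reg 3) (.reg 5)) (.sub (.const 1) (.sub (.const 4) (.reg 10)))

theorem halts_colorByGuess (hA : IsInput n A) (hB : Roomy B n) (hs : Ready n A s)
    (hmarks : MarksAt n L s) :
    Halts B colorByGuess s (100 * pos A n)
      fun s' => Ready n A s' ∧ ColorsAt n (guess A L) s' := by
  have hR := hB
  unfold Roomy at hB
  have hn := Nat.le_mul_self n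
  refine (halts_forVertices_of_linear hA hR (fun v s' => MarksAt n L s' ∧
      ∀ u < v, s'.mem (n * n + 1 + u) = guess A L u) 80
    ?_ ?_ hs ⟨hmarks, by simp⟩).mono le_rfl fun s' h => ⟨h.1, h.2.2⟩
  · exact fun v s x h => ⟨h, h⟩
  · rintro v hv t ht h5 h6 ⟨h1, h2⟩
    have hd := ht.input.length v hv
    have hp := hA.pos_add_le hv
    have hl := hA.length_lt v hv
    refine (Halts.seq (T := 2) (T' := 13 + ((10 + 20) * (A v).length + 20 + 12))
      (halts_assign (by simp [Expr.Fits]) (by simp [Expr.cost]) ?_)).mono (by omega) fun _ h => h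
    refine halts_assign_seq (by simp [Expr.Fits, Expr.eval, h6]; omega)
      (by simp [Expr.cost]; omega) ?_
    refine halts_assign_seq (by simp [Expr.Fits, Expr.eval, h6, hd]; omega)
      (by simp [Expr.cost]; omega) ?_
    refine (Halts.seq (T' := 12) ((halts_forList hR (hA.listAt hv) (fun l s' => s'.mem = t.mem ∧
      s'.reg 5 = v ∧ s'.reg 6 = pos A v ∧ s'.reg 10 = (l.filter (· ∉ L)).length) 10
      ?_ ?_ (((ht.setReg (by omega) _).setReg (by omega) _).setReg (by omega) _) ?_ ?_ ?_).mono
      le_rfl ?_)).mono ?_ fun _ h => h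
    · rintro l s x ⟨h1, h2, h3, h4⟩
      constructor <;> exact ⟨h1, by simpa, by simpa, by simpa using h4⟩
    · rintro l w hw hlA hwA r hr h9 ⟨h3, h4, h5, h7⟩
      have hm := h1 w hw
      rw [← h3] at hm
      have hlen := hlA.length_le
      have hfl := List.length_filter_le (· ∉ L) l
      refine halts_assign ?_ (by simp [Expr.cost]) ⟨hr.setReg (by omega) _, by simp, by simp,
        h3, by simpa, by simpa, ?_⟩
      · have : (if w ∈ L then 1 else 0) ≤ 1 := by split_ifs <;> omega
        simp only [Expr.Fits, Expr.eval, hr.mark, h9, hm, h7]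
        omega
      · simp only [State.setReg_reg, Expr.eval, hr.mark, h9, hm, h7, if_true, List.filter_append,
          List.length_append]
        by_cases hwL : w ∈ L <;> simp [hwL]
    · simp [Expr.eval, h6]
    · simp [Expr.eval, h6, hd]
    · simp [Expr.eval, h5, h6]
    · rintro r ⟨hr, h3, h4, h5, h7⟩
      have hg := guess_le_one (A := A) (L := L) v
      have hfl := List.length_filter_le (· ∉ L) (A v)
      refine halts_store (a := n * n + 1 + v) (x := guess A L v) ⟨?_, ?_⟩ ?_ ?_ (by simp [Expr.cost])
        ⟨hr.setMem hA (by omega) _, h4, h5, ?_, ?_⟩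
      · simp only [Expr.Fits, Expr.eval, hr.color, h4]; omega
      · simp only [Expr.Fits, h7]; omega
      · simp only [Expr.eval, hr.color, h4]
      · simp only [Expr.eval, h7, guess]
      · intro w hw
        rw [State.setMem_mem, if_neg (by omega), h3, h1 w hw]
      · intro u hu
        rw [State.setMem_mem]
        obtain rfl | hu : u = v ∨ u < v := by omega
        · rw [if_pos rfl]
        · rw [if_neg (by omega), h3, h2 u hu]
    · simp [Expr.cost]; omega

/-- The check was successful, and a root graph stands in the memory. -/
def Success (n : ℕ) (A : ℕ → List ℕ) (s : State) : Prop :=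
  s.reg 0 = 1 ∧ ∃ col : ℕ → ℕ, (∀ v, col v ≤ 1) ∧ (∀ v < n, VertexOk n A col v) ∧
    RootAt n A col n s

/-- Check all colorings that arise from the one in the memory by changing the colors of the first
`k` vertices, until a check is successful. -/
def bruteForce : ℕ → Program
  | 0 => check
  | k + 1 => .seq (.store (.add (.reg 3) (.const k)) (.const 0)) <| .seq (bruteForce k) <|
      .branch (.reg 0) .nop <|
      .seq (.store (.add (.reg 3) (.const k)) (.const 1)) (bruteForce k)

theorem ColorsAt.setMem (h : ColorsAt n col s) (k x : ℕ) :
    ColorsAt n (Function.update col k x) (s.setMem (n * n + 1 + k) x) := by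
  intro v hv
  rw [State.setMem_mem, Function.update_apply]
  by_cases hvk : v = k
  · simp [hvk]
  · rw [if_neg (by omega), if_neg hvk, h v hv]

theorem update_le_one (h : ∀ v, col v ≤ 1) {k x : ℕ} (hx : x ≤ 1) (v : ℕ) :
    Function.update col k x v ≤ 1 := by
  rw [Function.update_apply]
  split_ifs
  exacts [hx, h v]

/-- Colors are not restored after a failed branch. The failure case therefore also asserts that
memory holds some coloring `col'` agreeing with `col` from `k` on, which suffices to start the
second branch. The factor 4 per level pays for two recursive calls and the constant overhead. -/
theorem halts_bruteForce (hA : IsInput n A) (hB : Roomy B n) (k : ℕ) (hk : k ≤ 12)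
    (hc : ∀ v, col v ≤ 1) (hs : Ready n A s) (hcol : ColorsAt n col s) :
    Halts B (bruteForce k) s (400 * 4 ^ k * pos A n) fun s' => Ready n A s' ∧ (Success n A s' ∨
      (s'.reg 0 = 0 ∧ (∃ col' : ℕ → ℕ, (∀ v, col' v ≤ 1) ∧ (∀ v ≥ k, col' v = col v) ∧
          ColorsAt n col' s') ∧
        ∀ col' : ℕ → ℕ, (∀ v, col' v ≤ 1) → (∀ v ≥ k, col' v = col v) →
          ¬ ∀ v < n, VertexOk n A col' v)) := by
  have hR := hB
  unfold Roomy at hB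
  induction k generalizing col s with
  | zero =>
    refine (halts_check hA hR hc hs hcol).mono (by simp) ?_
    rintro s' ⟨h1, h2, h3, ⟨h4, h5⟩ | ⟨h4, u, hu, h5⟩⟩
    · exact ⟨h1, .inl ⟨h4, col, hc, h5, h3⟩⟩
    · refine ⟨h1, .inr ⟨h4, ⟨col, hc, fun _ _ => rfl, h2⟩, fun col' _ h' hok => h5 ?_⟩⟩
      obtain rfl : col' = col := funext fun v => h' v (by omega)
      exact hok u hu
  | succ k ih =>
    have hp : 1 ≤ pos A n := by unfold pos; omega
    have hT : 1 ≤ 4 ^ k * pos A n := Nat.mul_pos (by positivity) hp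
    have hstore : ∀ {s : State}, Ready n A s → ∀ x ≤ 1,
        ((Expr.reg 3).add (.const k)).Fits B s ∧ (Expr.const x).Fits B s := by
      intro s hs x hx
      simp only [Expr.Fits, Expr.eval, hs.color]
      omega
    refine (Halts.seq (T := 5) (T' := 400 * 4 ^ k * pos A n + (7 + 400 * 4 ^ k * pos A n))
      (halts_store (a := n * n + 1 + k) (hstore hs 0 (by omega))
        (by simp only [Expr.eval, hs.color]) rfl (by simp [Expr.cost])
      (Halts.seq ((ih (by omega) (update_le_one hc zero_le_one) (hs.setMem hA (by omega) _)
        (hcol.setMem k 0)).mono le_rfl ?_)))).mono (by rw [pow_succ]; nlinarith) fun _ h => h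
    rintro t ⟨ht, hsucc | ⟨h0, ⟨col', hc', heq, hcol'⟩, hno⟩⟩
    · have h0 := hsucc.1
      refine halts_branch (by simp only [Expr.Fits]; omega) (by simp [Expr.cost]; omega)
        (fun _ => halts_nop (by simp [Expr.cost]; omega) ⟨ht, .inl hsucc⟩)
        (fun h => by simp [Expr.eval, h0] at h)
    · refine halts_branch (by simp only [Expr.Fits]; omega) (by simp [Expr.cost]; omega)
        (fun h => absurd h0 h) fun _ => ?_
      refine halts_store_seq (a := n * n + 1 + k) (hstore ht 1 le_rfl)
        (by simp only [Expr.eval, ht.color]) rfl (by simp [Expr.cost]; omega) ?_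
      refine (ih (by omega) (update_le_one hc' le_rfl) (ht.setMem hA (by omega) _)
        (hcol'.setMem k 1)).mono (by simp [Expr.cost]; omega) ?_
      rintro r ⟨hr, hsucc | ⟨h0, ⟨col₂, hc₂, heq₂, hcol₂⟩, hno₂⟩⟩
      · exact ⟨hr, .inl hsucc⟩
      have hcol' : ∀ v ≥ k + 1, col' v = col v := fun v hv => by
        rw [heq v (by omega), Function.update_of_ne (by omega)]
      refine ⟨hr, .inr ⟨h0, ⟨col₂, hc₂, fun v hv => ?_, hcol₂⟩, fun col₃ hc₃ heq₃ => ?_⟩⟩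
      · rw [heq₂ v (by omega), Function.update_of_ne (by omega), hcol' v hv]
      · obtain h | h : col₃ k = 0 ∨ col₃ k = 1 := by have := hc₃ k; omega
        · refine hno col₃ hc₃ fun v hv => ?_
          obtain rfl | hv : v = k ∨ k + 1 ≤ v := by omega
          · simpa
          · rw [Function.update_of_ne (by omega), heq₃ v hv]
        · refine hno₂ col₃ hc₃ fun v hv => ?_
          obtain rfl | hv : v = k ∨ k + 1 ≤ v := by omega
          · simpa
          · rw [Function.update_of_ne (by omega), heq₃ v hv, hcol' v hv]

/-- The recognition algorithm. -/
def recognize : Program :=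
  .seq setup <| .seq findPivot <| .seq markList <| .seq colorByGuess <|
  .seq check <| .branch (.reg 0) .nop (bruteForce 12)

/-- The exhaustive search runs for every `n` after a failed guess: its cost is a constant number of
checks, and any success is certified by `check`. -/
theorem halts_recognize (hA : IsInput n A) (hB : Roomy B n) (hs : InputAt n A s)
    (hreg : ∀ r, s.reg r = 0) (hmem : ∀ a ≥ n * n + 1, s.mem a = 0) :
    Halts B recognize s ((1000 + 400 * 4 ^ 12) * pos A n) fun s' => s'.reg 1 = n * n + 2 * n + 13 ∧
      (Success n A s' ∨ (s'.reg 0 = 0 ∧ ∃ L, IsPivot n A n L ∧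
        (¬ ∀ v < n, VertexOk n A (guess A L) v) ∧
        ∀ col : ℕ → ℕ, (∀ v, col v ≤ 1) → (∀ v ≥ 12, col v = guess A L v) →
          ¬ ∀ v < n, VertexOk n A col v)) := by
  -- Lets `pos A n` absorb the cost of marking at most `n` vertices as well as additive constants.
  have hp : n + 1 ≤ pos A n := by
    have : ∑ u ∈ Finset.range n, 1 ≤ ∑ u ∈ Finset.range n, ((A u).length + 1) :=
      Finset.sum_le_sum fun u _ => by omega
    rw [Finset.sum_const, Finset.card_range, smul_eq_mul] at this
    unfold pos; omega
  refine (Halts.seq (T' := 50 * pos A n + (50 * pos A n + (100 * pos A n +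
    (400 * pos A n + (10 + 400 * 4 ^ 12 * pos A n))))) ((halts_setup hB hs hreg).mono le_rfl
    ?_)).mono (by rw [Nat.add_mul]; omega) fun _ h => h
  rintro s₁ ⟨hs₁, hmem₁, h7, h8⟩
  refine Halts.seq ((halts_findPivot hA hB hs₁ h7 h8).mono le_rfl ?_)
  rintro s₂ ⟨hs₂, hmem₂, L, hL, h8, hpiv⟩
  have hlen : L.length ≤ n := by
    rcases hpiv with ⟨v, -, -, h⟩ | ⟨rfl, -⟩
    · omega
    · simp
  refine Halts.seq ((halts_markList hA hB hs₂ hL h8 (by rwa [hmem₂, hmem₁])).mono (by omega) ?_)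
  rintro s₃ ⟨hs₃, hmarks⟩
  refine Halts.seq ((halts_colorByGuess hA hB hs₃ hmarks).mono le_rfl ?_)
  rintro s₄ ⟨hs₄, hcol⟩
  refine Halts.seq ((halts_check hA hB guess_le_one hs₄ hcol).mono le_rfl ?_)
  rintro s₅ ⟨hs₅, hcol₅, hroot, ⟨h0, hok⟩ | ⟨h0, u, hu, hno⟩⟩
  · refine halts_branch (by simp only [Expr.Fits]; unfold Roomy at hB; omega)
      (by simp [Expr.cost]; omega)
      (fun _ => halts_nop (by simp [Expr.cost]; omega)
        ⟨hs₅.out, .inl ⟨h0, _, guess_le_one, hok, hroot⟩⟩)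
      (fun h => by simp [Expr.eval, h0] at h)
  · refine halts_branch (by simp only [Expr.Fits]; omega) (by simp [Expr.cost]; omega)
      (fun h => absurd h0 h) fun _ => ?_
    refine (halts_bruteForce hA hB 12 le_rfl guess_le_one hs₅ hcol₅).mono
      (by simp [Expr.cost]; omega) ?_
    rintro s₆ ⟨hs₆, hsucc | ⟨h0, -, hno'⟩⟩
    · exact ⟨hs₆.out, .inl hsucc⟩
    · exact ⟨hs₆.out, .inr ⟨h0, L, hpiv, fun h => hno (h u hu), hno'⟩⟩

end RAM

/-! ### Correctness of the search -/

namespace RAM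

/-- The lists `A 0, …, A (n - 1)` are the adjacency lists of a graph on `n` vertices. -/
structure IsGraphInput (n : ℕ) (A : ℕ → List ℕ) : Prop extends IsInput n A where
  nodup : ∀ v < n, (A v).Nodup
  irrefl : ∀ v < n, v ∉ A v

/-- The color classes are cliques, and every vertex has at most two neighbors with another
color. -/
structure IsCliqueColoring (n : ℕ) (A : ℕ → List ℕ) (col : ℕ → ℕ) : Prop where
  mem : ∀ v < n, ∀ w < n, v ≠ w → col v = col w → w ∈ A v
  cross_le : ∀ v < n, (cross A col v).length ≤ 2

variable {n : ℕ} {A : ℕ → List ℕ} {col : ℕ → ℕ} {L : List ℕ}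

/-- The vertex `v` together with its neighbors of its own color is a subset of its class. The degree
inequality forces equal cardinalities, hence equality of the sets. -/
theorem forall_vertexOk_iff (hA : IsGraphInput n A) :
    (∀ v < n, VertexOk n A col v) ↔ IsCliqueColoring n A col := by
  have key : ∀ v < n, ((cross A col v).length + classSize n col (col v) ≤ (A v).length + 1 ↔
      ∀ w < n, v ≠ w → col v = col w → w ∈ A v) := by
    intro v hv
    have hlen := List.length_eq_length_filter_add (l := A v) (fun w => decide (col w ≠ col v))
    change _ = (cross A col v).length + _ at hlen
    set same := (A v).filter (fun w => !decide (col w ≠ col v)) with hsame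
    have hmem : ∀ w, w ∈ same ↔ w ∈ A v ∧ col w = col v := by simp [hsame]
    have hcard : (insert v same.toFinset).card = same.length + 1 := by
      rw [Finset.card_insert_of_notMem, List.toFinset_card_of_nodup ((hA.nodup v hv).filter _)]
      rw [List.mem_toFinset, hmem]
      exact fun h => hA.irrefl v hv h.1
    have hsub : insert v same.toFinset ⊆ (Finset.range n).filter (col · = col v) := by
      intro w hw
      rw [Finset.mem_insert, List.mem_toFinset, hmem] at hw
      rw [Finset.mem_filter, Finset.mem_range]
      rcases hw with rfl | ⟨hw, hc⟩
      · exact ⟨hv, rfl⟩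
      · exact ⟨hA.lt v hv w hw, hc⟩
    constructor
    · intro h w hw hvw hc
      have heq := Finset.eq_of_subset_of_card_le hsub (by
        rw [hcard]; unfold classSize at h; omega)
      have : w ∈ insert v same.toFinset := by
        rw [heq, Finset.mem_filter, Finset.mem_range]
        exact ⟨hw, hc.symm⟩
      rw [Finset.mem_insert, List.mem_toFinset, hmem] at this
      exact (this.resolve_left hvw.symm).1
    · intro h
      have : (Finset.range n).filter (col · = col v) ⊆ insert v same.toFinset := by
        intro w hw
        rw [Finset.mem_filter, Finset.mem_range] at hw
        rw [Finset.mem_insert, List.mem_toFinset, hmem]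
        by_cases hvw : w = v
        · exact .inl hvw
        · exact .inr ⟨h w hw.1 (Ne.symm hvw) hw.2.symm, hw.2⟩
      have := Finset.card_le_card this
      unfold classSize
      omega
  constructor
  · exact fun h => ⟨fun v hv => (key v hv).1 (h v hv).2, fun v hv => (h v hv).1⟩
  · exact fun h v hv => ⟨h.cross_le v hv, (key v hv).2 (h.mem v hv)⟩

/-- Only the partition into classes matters, so a guess may interchange the two colors. -/
theorem IsCliqueColoring.congr (hA : IsInput n A) (h : IsCliqueColoring n A col) {g : ℕ → ℕ}
    (hg : ∀ v < n, ∀ w < n, g v = g w ↔ col v = col w) : IsCliqueColoring n A g where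
  mem v hv w hw hvw h' := h.mem v hv w hw hvw ((hg v hv w hw).1 h')
  cross_le v hv := by
    have : cross A g v = cross A col v := List.filter_congr fun w hw => by
      simp only [ne_eq, hg w (hA.lt v hv w hw) v hv]
    rw [this]
    exact h.cross_le v hv

/-! ### Recovering the coloring from non-neighbors -/

theorem card_diff_neighbors (hA : IsGraphInput n A) {v : ℕ} (hv : v < n) :
    ((Finset.range n \ (A v).toFinset).erase v).card = n - (A v).length - 1 := by
  rw [Finset.card_erase_of_mem, Finset.card_sdiff_of_subset, Finset.card_range,
    List.toFinset_card_of_nodup (hA.nodup v hv)]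
  · intro w hw
    exact Finset.mem_range.2 (hA.lt v hv w (List.mem_toFinset.1 hw))
  · rw [Finset.mem_sdiff, Finset.mem_range, List.mem_toFinset]
    exact ⟨hv, hA.irrefl v hv⟩

/-- If `u` has the color of `v`, its neighbors outside `A v` are among `v` and its at most two
neighbors of the other color. Otherwise the at least five non-neighbors of `v` lie in the class of
`u`, and all but possibly `u` itself are neighbors of `u`. So 3 and 4 separate the cases. -/
theorem guess_of_pivot (hA : IsGraphInput n A) (h : IsCliqueColoring n A col)
    (hc : ∀ v, col v ≤ 1) {v : ℕ} (hv : v < n) (hd : (A v).length + 6 ≤ n) {u : ℕ} (hu : u < n) :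
    guess A (A v) u = if col u = col v then 0 else 1 := by
  have hcard : ((A u).filter (· ∉ A v)).toFinset.card = ((A u).filter (· ∉ A v)).length :=
    List.toFinset_card_of_nodup ((hA.nodup u hu).filter _)
  have hmem : ∀ w, w ∈ ((A u).filter (· ∉ A v)).toFinset ↔ w ∈ A u ∧ w ∉ A v := by simp
  have hcol : ∀ w < n, w ≠ v → w ∉ A v → col w ≠ col v := fun w hw hwv hwA hcw =>
    hwA (h.mem v hv w hw hwv.symm hcw.symm)
  unfold guess
  split_ifs with huv
  · have hsub : ((A u).filter (· ∉ A v)).toFinset ⊆ insert v (cross A col u).toFinset := by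
      intro w hw
      rw [hmem] at hw
      rw [Finset.mem_insert, List.mem_toFinset, cross, List.mem_filter]
      by_cases hwv : w = v
      · exact .inl hwv
      · refine .inr ⟨hw.1, ?_⟩
        simpa [huv] using hcol w (hA.lt u hu w hw.1) hwv hw.2
    have h1 := Finset.card_le_card hsub
    have h2 := Finset.card_insert_le v (cross A col u).toFinset
    have h3 := List.toFinset_card_le (cross A col u)
    have h4 := h.cross_le u hu
    omega
  · have hsub : ((Finset.range n \ (A v).toFinset).erase v).erase u ⊆
        ((A u).filter (· ∉ A v)).toFinset := by
      intro w hw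
      simp only [Finset.mem_erase, Finset.mem_sdiff, Finset.mem_range, List.mem_toFinset] at hw
      obtain ⟨hwu, hwv, hwn, hwA⟩ := hw
      rw [hmem]
      refine ⟨h.mem u hu w hwn hwu.symm ?_, hwA⟩
      have := hcol w hwn hwv hwA
      have := hc w
      have := hc u
      have := hc v
      omega
    have h1 := Finset.card_le_card hsub
    have h2 := Finset.pred_card_le_card_erase (s := (Finset.range n \ (A v).toFinset).erase v)
      (a := u)
    rw [card_diff_neighbors hA hv] at h2
    omega

/-- The class opposite to `u` consists of at most two neighbors and at most four non-neighbors of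
`u`. -/
theorem card_class_le (hA : IsGraphInput n A) (h : IsCliqueColoring n A col) {u v : ℕ}
    (hu : u < n) (huv : col u ≠ col v) (hd : n < (A u).length + 6) :
    ((Finset.range n).filter (col · = col v)).card ≤ 6 := by
  have hsub : (Finset.range n).filter (col · = col v) ⊆
      (cross A col u).toFinset ∪ (Finset.range n \ (A u).toFinset).erase u := by
    intro w hw
    rw [Finset.mem_filter, Finset.mem_range] at hw
    simp only [Finset.mem_union, Finset.mem_erase, Finset.mem_sdiff, Finset.mem_range,
      List.mem_toFinset, cross, List.mem_filter, decide_eq_true_eq]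
    by_cases hwA : w ∈ A u
    · exact .inl ⟨hwA, by rw [hw.2]; exact huv.symm⟩
    · exact .inr ⟨fun h => huv (h ▸ hw.2), hw.1, hwA⟩
  have h1 := Finset.card_le_card hsub
  have h2 := Finset.card_union_le (cross A col u).toFinset
    ((Finset.range n \ (A u).toFinset).erase u)
  have h3 := List.toFinset_card_le (cross A col u)
  have h4 := h.cross_le u hu
  rw [card_diff_neighbors hA hu] at h2
  omega

theorem color_eq_of_no_pivot (hA : IsGraphInput n A) (h : IsCliqueColoring n A col)
    (hc : ∀ v, col v ≤ 1) (hn : 12 < n) (hd : ∀ v < n, n < (A v).length + 6) {u v : ℕ}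
    (hu : u < n) (hv : v < n) : col u = col v := by
  by_contra huv
  have h1 := card_class_le hA h hu huv (hd u hu)
  have h2 := card_class_le hA h hv (Ne.symm huv) (hd v hv)
  have hsub : Finset.range n ⊆ (Finset.range n).filter (col · = col u) ∪
      (Finset.range n).filter (col · = col v) := by
    intro w hw
    rw [Finset.mem_union, Finset.mem_filter, Finset.mem_filter]
    have : col w = col u ∨ col w = col v := by
      have := hc w
      have := hc u
      have := hc v
      omega
    exact this.imp (⟨hw, ·⟩) (⟨hw, ·⟩)
  have h3 := (Finset.card_le_card hsub).trans (Finset.card_union_le _ _)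
  rw [Finset.card_range] at h3
  omega

theorem isCliqueColoring_guess (hA : IsGraphInput n A) (h : IsCliqueColoring n A col)
    (hc : ∀ v, col v ≤ 1) (hL : IsPivot n A n L) (hn : 12 < n) :
    IsCliqueColoring n A (guess A L) := by
  refine h.congr hA.toIsInput fun u hu w hw => ?_
  rcases hL with ⟨v, hv, rfl, hd⟩ | ⟨rfl, hd⟩
  · rw [guess_of_pivot hA h hc hv hd hu, guess_of_pivot hA h hc hv hd hw]
    have := hc u
    have := hc w
    have := hc v
    split_ifs <;> constructor <;> intro _ <;> first | contradiction | omega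
  -- With `L` empty all neighbors count, and every degree exceeds n - 6 ≥ 7.
  · have hg : ∀ v < n, guess A [] v = 1 := fun v hv => by
      have := hd v hv
      simp only [guess, List.not_mem_nil, not_false_eq_true, decide_true, List.filter_true]
      omega
    rw [hg u hu, hg w hw]
    simpa using color_eq_of_no_pivot hA h hc hn hd hu hw

/-- If there is a suitable coloring, then the search finds one. -/
theorem exists_candidate (hA : IsGraphInput n A) (h : IsCliqueColoring n A col)
    (hc : ∀ v, col v ≤ 1) (hL : IsPivot n A n L) :
    IsCliqueColoring n A (guess A L) ∨ ∃ g : ℕ → ℕ, (∀ v, g v ≤ 1) ∧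
      (∀ v ≥ 12, g v = guess A L v) ∧
      IsCliqueColoring n A g := by
  by_cases hn : 12 < n
  · exact .inl (isCliqueColoring_guess hA h hc hL hn)
  -- Here n ≤ 12, so this function agrees with `col` on all vertices.
  · refine .inr ⟨fun v => if v < 12 then col v else guess A L v, fun v => ?_, fun v hv => ?_,
      h.congr hA.toIsInput fun v hv w hw => ?_⟩
    · dsimp only
      split_ifs
      exacts [hc v, guess_le_one v]
    · exact if_neg (by omega)
    · rw [if_pos (by omega), if_pos (by omega)]

/-- The number of pairs of vertices is linear in the size of the input. -/
theorem sq_le_of_vertexOk (hc : ∀ v, col v ≤ 1) (h : ∀ v < n, VertexOk n A col v) :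
    n * n ≤ 2 * ∑ v ∈ Finset.range n, (A v).length + 2 * n := by
  have h1 : ∑ v ∈ Finset.range n, classSize n col (col v) ≤
      ∑ v ∈ Finset.range n, ((A v).length + 1) := Finset.sum_le_sum fun v hv => by
    have := (h v (Finset.mem_range.1 hv)).2
    omega
  have h2 : ∑ v ∈ Finset.range n, classSize n col (col v) =
      classSize n col 0 * classSize n col 0 + classSize n col 1 * classSize n col 1 := by
    have hf : (Finset.range n).filter (¬ col · = 0) = (Finset.range n).filter (col · = 1) := by
      ext u
      have := hc u
      rw [Finset.mem_filter, Finset.mem_filter]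
      exact and_congr_right fun _ => by omega
    rw [← Finset.sum_filter_add_sum_filter_not (Finset.range n) (col · = 0), hf]
    rw [Finset.sum_congr rfl (g := fun _ => classSize n col 0) fun v hv => by
        rw [(Finset.mem_filter.1 hv).2],
      Finset.sum_congr (s₁ := (Finset.range n).filter (col · = 1)) rfl
        (g := fun _ => classSize n col 1) fun v hv => by rw [(Finset.mem_filter.1 hv).2],
      Finset.sum_const, Finset.sum_const, smul_eq_mul, smul_eq_mul]
    rfl
  have h3 : classSize n col 0 + classSize n col 1 = n := by
    rw [classSize_eq hc 0 zero_le_one, classSize_eq hc 1 le_rfl]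
    have := sum_le_of_le_one hc n
    simp only [zero_mul, one_mul, Nat.sub_self, Nat.sub_zero]
    omega
  rw [h2, Finset.sum_add_distrib, Finset.sum_const, Finset.card_range, smul_eq_mul, mul_one] at h1
  generalize classSize n col 0 = a at *
  generalize classSize n col 1 = b at *
  subst h3
  zify at h1 ⊢
  -- With class sizes a and b, (a + b)² ≤ 2(a² + b²), and a² + b² is at most the sum of the degrees
  -- plus n.
  nlinarith [sq_nonneg ((a : ℤ) - b)]

end RAM

/-! ### Color-line graphs and clique colorings -/

/-- A graph on `V` is a color-line graph if edges `s(a v, b v)` with the right incidences are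
assigned to its vertices. -/
theorem exists_iso_colorLineGraph {V W C : Type*} (G : SimpleGraph V) (a b : V → W) (col : V → C)
    (hab : ∀ v, a v ≠ b v) (hinj : Function.Injective fun v => s(a v, b v))
    (hadj : ∀ v w, v ≠ w → ((∃ z, z ∈ s(a v, b v) ∧ z ∈ s(a w, b w)) ↔
      G.Adj v w ∧ col v ≠ col w))
    (hcol : ∀ v w, v ≠ w → col v = col w → G.Adj v w) :
    ∃ (H : SimpleGraph W) (φ : H.edgeSet → C) (ψ : G ≃g colorLineGraph H φ),
      IsProperEdgeColoring φ ∧ (∀ v, (ψ v : Sym2 W) = s(a v, b v)) ∧ ∀ v, φ (ψ v) = col v := by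
  set e : V → Sym2 W := fun v => s(a v, b v) with he
  have hH : (SimpleGraph.fromEdgeSet (Set.range e)).edgeSet = Set.range e := by
    rw [SimpleGraph.edgeSet_fromEdgeSet, sdiff_eq_left, Set.disjoint_left]
    rintro _ ⟨v, rfl⟩ h
    exact hab v (by simpa [he] using h)
  let ψ : V ≃ (SimpleGraph.fromEdgeSet (Set.range e)).edgeSet :=
    (Equiv.ofInjective e hinj).trans (Equiv.setCongr hH.symm)
  have hψ : ∀ v, (ψ v : Sym2 W) = s(a v, b v) := fun v => rfl
  have hline : ∀ v w, (SimpleGraph.fromEdgeSet (Set.range e)).lineGraph.Adj (ψ v) (ψ w) ↔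
      v ≠ w ∧ G.Adj v w ∧ col v ≠ col w := by
    intro v w
    rw [SimpleGraph.lineGraph_adj_iff_exists, hψ, hψ, ψ.injective.ne_iff]
    exact and_congr_right fun h => hadj v w h
  refine ⟨_, fun f => col (ψ.symm f), ⟨ψ, fun {v w} => ?_⟩, fun f g h => ?_, hψ, fun v => ?_⟩
  · simp only [colorLineGraph, hline, Equiv.symm_apply_apply, ψ.injective.ne_iff]
    constructor
    · rintro (h | h)
      exacts [h.2.1, hcol v w h.1 h.2]
    · intro h
      by_cases hc : col v = col w
      exacts [.inr ⟨h.ne, hc⟩, .inl ⟨h.ne, h, hc⟩]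
  · obtain ⟨v, rfl⟩ := ψ.surjective f
    obtain ⟨w, rfl⟩ := ψ.surjective g
    simpa using ((hline v w).1 h).2.2
  · exact congrArg col (ψ.symm_apply_apply v)

/-- In a proper `2`-color-line graph, every vertex has at most two neighbors of the other color. -/
theorem ncard_cross_le_two {V W : Type*} [Finite V] {G : SimpleGraph V} {H : SimpleGraph W}
    {φ : H.edgeSet → Fin 2} (hφ : IsProperEdgeColoring φ) (ψ : G ≃g colorLineGraph H φ) (v : V) :
    {w | G.Adj v w ∧ φ (ψ w) ≠ φ (ψ v)}.ncard ≤ 2 := by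
  have hshare : ∀ w, G.Adj v w ∧ φ (ψ w) ≠ φ (ψ v) →
      ∃ z, z ∈ (ψ v : Sym2 W) ∧ z ∈ (ψ w : Sym2 W) := by
    rintro w ⟨h, hc⟩
    rw [← ψ.map_adj_iff] at h
    rcases h with h | h
    · exact (SimpleGraph.lineGraph_adj_iff_exists.1 h).2
    · exact absurd h.2.symm hc
  obtain ⟨⟨x, y⟩, hxy⟩ := (ψ v : Sym2 W).exists_rep
  have : Nonempty W := ⟨x⟩
  choose! z hz hz' using hshare
  have hsub : z '' {w | G.Adj v w ∧ φ (ψ w) ≠ φ (ψ v)} ⊆ {x, y} := by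
    rintro _ ⟨w, hw, rfl⟩
    have := hz w hw
    rw [← hxy] at this
    simpa using this
  -- With only two colors, all these `w` have the same color, so properness forbids two of them at
  -- one end of the edge of `v`.
  have hinj : Set.InjOn z {w | G.Adj v w ∧ φ (ψ w) ≠ φ (ψ v)} := by
    intro w hw w' hw' h
    by_contra hne
    have hadj : H.lineGraph.Adj (ψ w) (ψ w') := SimpleGraph.lineGraph_adj_iff_exists.2
      ⟨ψ.injective.ne hne, z w, hz' w hw, h ▸ hz' w' hw'⟩
    have h1 := hφ _ _ hadj
    have h2 := hw.2
    have h3 := hw'.2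
    omega
  rw [← hinj.ncard_image]
  refine (Set.ncard_le_ncard hsub).trans ((Set.ncard_insert_le x {y}).trans ?_)
  rw [Set.ncard_singleton]

/-! ### Decoding the input and the output -/

namespace RAM

/-- The difference is at most the sum, hence smaller than the gap 2(v + x) + 1 to the next square.
So the code determines the sum, then the absolute difference, then the unordered pair. -/
theorem pairCode_inj {v w x y : ℕ} (h : pairCode v x = pairCode w y) :
    (v = w ∧ x = y) ∨ (v = y ∧ x = w) := by
  unfold pairCode at h
  have hsum : v + x = w + y := by
    rcases lt_trichotomy (v + x) (w + y) with hlt | heq | hlt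
    · have := Nat.mul_le_mul (Nat.succ_le_of_lt hlt) (Nat.succ_le_of_lt hlt)
      simp only [Nat.succ_eq_add_one, Nat.add_mul, Nat.mul_add] at this h
      omega
    · exact heq
    · have := Nat.mul_le_mul (Nat.succ_le_of_lt hlt) (Nat.succ_le_of_lt hlt)
      simp only [Nat.succ_eq_add_one, Nat.add_mul, Nat.mul_add] at this h
      omega
  rw [hsum] at h
  omega

theorem State.holdsAt_cons {s : State} {a x : ℕ} {l : List ℕ} :
    s.HoldsAt a (x :: l) ↔ s.mem a = x ∧ s.HoldsAt (a + 1) l := by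
  constructor
  · exact fun h => ⟨h 0 (by simp), fun i hi => by
      have := h (i + 1) (by simpa using hi)
      rwa [List.getElem_cons_succ, ← add_assoc, add_right_comm] at this⟩
  · rintro ⟨h, h'⟩ (_ | i) hi
    · exact h
    · have := h' i (by simpa using hi)
      rwa [List.getElem_cons_succ, ← add_assoc, add_right_comm]

theorem State.holdsAt_append {s : State} {a : ℕ} {l l' : List ℕ} :
    s.HoldsAt a (l ++ l') ↔ s.HoldsAt a l ∧ s.HoldsAt (a + l.length) l' := by
  induction l generalizing a with
  | nil => simp [State.HoldsAt]
  | cons x l ih =>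
    rw [List.cons_append, holdsAt_cons, holdsAt_cons, ih, List.length_cons, and_assoc,
      add_assoc, Nat.add_comm 1]

/-- The neighbors of the vertices as lists of numbers. -/
def listsOf {n : ℕ} (adj : Fin n → List (Fin n)) (v : ℕ) : List ℕ :=
  if h : v < n then (adj ⟨v, h⟩).map Fin.val else []

variable {n : ℕ} {G : SimpleGraph (Fin n)} {adj : Fin n → List (Fin n)}

theorem listsOf_coe (v : Fin n) : listsOf adj v = (adj v).map Fin.val :=
  dif_pos v.2

theorem mem_listsOf (hadj : IsAdjacencyList G adj) (v w : Fin n) :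
    (w : ℕ) ∈ listsOf adj v ↔ G.Adj v w := by
  rw [listsOf_coe, ← (hadj v).2 w]
  exact List.mem_map_of_injective Fin.val_injective

theorem isGraphInput_listsOf (hadj : IsAdjacencyList G adj) : IsGraphInput n (listsOf adj) := by
  have hlt : ∀ v < n, ∀ w ∈ listsOf adj v, w < n := by
    intro v hv w hw
    rw [listsOf_coe ⟨v, hv⟩] at hw
    obtain ⟨w, -, rfl⟩ := List.mem_map.1 hw
    exact w.2
  have hnodup : ∀ v < n, (listsOf adj v).Nodup := by
    intro v hv
    rw [listsOf_coe ⟨v, hv⟩]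
    exact (hadj _).1.map Fin.val_injective
  have hirrefl : ∀ v < n, v ∉ listsOf adj v := fun v hv h =>
    G.irrefl ((mem_listsOf hadj ⟨v, hv⟩ ⟨v, hv⟩).1 h)
  refine ⟨⟨hlt, fun v hv => ?_⟩, hnodup, hirrefl⟩
  have hsub : insert v (listsOf adj v).toFinset ⊆ Finset.range n := by
    intro w hw
    rw [Finset.mem_insert, List.mem_toFinset] at hw
    rcases hw with rfl | hw
    exacts [Finset.mem_range.2 hv, Finset.mem_range.2 (hlt v hv w hw)]
  have := Finset.card_le_card hsub
  rw [Finset.card_insert_of_notMem (by rw [List.mem_toFinset]; exact hirrefl v hv),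
    List.toFinset_card_of_nodup (hnodup v hv), Finset.card_range] at this
  exact this

theorem sum_length_listsOf (hadj : IsAdjacencyList G adj) :
    ∑ v ∈ Finset.range n, (listsOf adj v).length = 2 * G.edgeSet.ncard := by
  classical
  rw [Finset.sum_range, ← SimpleGraph.coe_edgeFinset, Set.ncard_coe_finset,
    ← SimpleGraph.sum_degrees_eq_twice_card_edges]
  refine Finset.sum_congr rfl fun v _ => ?_
  rw [listsOf_coe, List.length_map, ← List.toFinset_card_of_nodup (hadj v).1,
    ← SimpleGraph.card_neighborFinset_eq_degree]
  congr 1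
  ext w
  rw [List.mem_toFinset, (hadj v).2, SimpleGraph.mem_neighborFinset]

theorem encodeAdjacencyList_eq (adj : Fin n → List (Fin n)) : encodeAdjacencyList adj =
    n :: (List.finRange n).flatMap fun v => (adj v).length :: (adj v).map Fin.val := by
  simp [encodeAdjacencyList, List.map_eq_flatMap]

/-- Splitting off one vertex entry at a time locates every entry; the length equation at k = n gives
the total input length. -/
theorem holdsAt_suffix (adj : Fin n → List (Fin n)) (k : ℕ) (hk : k ≤ n) :
    (State.init (encodeAdjacencyList adj)).HoldsAt (pos (listsOf adj) k)
        (((List.finRange n).drop k).flatMap fun v =>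
          (adj v).length :: (adj v).map Fin.val) ∧
      (encodeAdjacencyList adj).length = pos (listsOf adj) k +
        (((List.finRange n).drop k).flatMap fun v =>
          (adj v).length :: (adj v).map Fin.val).length := by
  induction k with
  | zero =>
    have h : (State.init (encodeAdjacencyList adj)).HoldsAt 0 (encodeAdjacencyList adj) :=
      fun i hi => by simp [State.init, hi]
    rw [encodeAdjacencyList_eq] at h ⊢
    refine ⟨(State.holdsAt_cons.1 h).2, ?_⟩
    simp only [pos, List.length_cons, List.drop_zero, Finset.range_zero,
      Finset.sum_empty]
    omega
  | succ k ih =>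
    obtain ⟨h, h'⟩ := ih (by omega)
    rw [List.drop_eq_getElem_cons (by simpa using hk), List.flatMap_cons] at h h'
    rw [List.getElem_finRange] at h h'
    have hlen : (listsOf adj k).length = (adj ⟨k, hk⟩).length := by
      rw [listsOf_coe ⟨k, hk⟩, List.length_map]
    rw [State.holdsAt_append] at h
    rw [pos_succ, hlen]
    simp only [List.length_append, List.length_cons, List.length_map] at h h'
    exact ⟨by simpa [add_assoc] using h.2, by simp at h' ⊢; omega⟩

theorem inputAt_init (adj : Fin n → List (Fin n)) :
    InputAt n (listsOf adj) (State.init (encodeAdjacencyList adj)) := by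
  have key : ∀ v (hv : v < n), (State.init (encodeAdjacencyList adj)).HoldsAt
      (pos (listsOf adj) v) ((listsOf adj v).length :: listsOf adj v) := by
    intro v hv
    have h := (holdsAt_suffix adj v hv.le).1
    rw [List.drop_eq_getElem_cons (by simpa using hv), List.flatMap_cons, List.getElem_finRange,
      State.holdsAt_append] at h
    have hlist : listsOf adj v = (adj ⟨v, hv⟩).map Fin.val := listsOf_coe ⟨v, hv⟩
    rw [hlist, List.length_map]
    exact h.1
  exact ⟨by simp [State.init, encodeAdjacencyList], fun v hv => (State.holdsAt_cons.1 (key v hv)).1,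
    fun v hv => (State.holdsAt_cons.1 (key v hv)).2⟩

theorem length_encodeAdjacencyList (adj : Fin n → List (Fin n)) :
    (encodeAdjacencyList adj).length = pos (listsOf adj) n := by
  have h := (holdsAt_suffix adj n le_rfl).2
  rwa [List.drop_of_length_le (by simp), List.flatMap_nil, List.length_nil, add_zero] at h

/-- A proper `2`-color-line graph has a suitable coloring. -/
theorem exists_isCliqueColoring (hadj : IsAdjacencyList G adj) (h : IsProperColorLineGraph 2 G) :
    ∃ col : ℕ → ℕ, (∀ v, col v ≤ 1) ∧ IsCliqueColoring n (listsOf adj) col := by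
  obtain ⟨W, -, H, φ, hφ, ⟨ψ⟩⟩ := h
  have hcol : ∀ v : Fin n, (if h : (v : ℕ) < n then (φ (ψ ⟨v, h⟩) : ℕ) else 0) = φ (ψ v) :=
    fun v => dif_pos v.2
  refine ⟨fun v => if h : v < n then (φ (ψ ⟨v, h⟩) : ℕ) else 0, fun v => ?_, fun v hv w hw hvw h =>
    ?_, fun v hv => ?_⟩
  · dsimp only
    split_ifs
    · omega
    · omega
  · lift v to Fin n using hv
    lift w to Fin n using hw
    simp only [hcol] at h
    rw [mem_listsOf hadj, ← ψ.map_adj_iff]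
    exact .inr ⟨ψ.injective.ne fun h => hvw (congrArg _ h), Fin.ext h⟩
  · lift v to Fin n using hv
    have hnd : (cross (listsOf adj) (fun v => if h : v < n then (φ (ψ ⟨v, h⟩) : ℕ) else 0) v).Nodup :=
      ((isGraphInput_listsOf hadj).nodup v v.2).filter _
    rw [← List.toFinset_card_of_nodup hnd]
    refine le_trans ?_ (ncard_cross_le_two hφ ψ v)
    rw [← Set.ncard_image_of_injective _ Fin.val_injective, ← Set.ncard_coe_finset]
    refine Set.ncard_le_ncard (fun w hw => ?_) (Set.toFinite _)
    rw [Finset.mem_coe, List.mem_toFinset, cross, List.mem_filter, decide_eq_true_eq] at hw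
    obtain ⟨hw, hc⟩ := hw
    lift w to Fin n using (isGraphInput_listsOf hadj).lt v v.2 w hw
    simp only [hcol] at hc
    exact ⟨w, ⟨(mem_listsOf hadj v w).1 hw, fun h => hc (congrArg _ h)⟩, rfl⟩

theorem holdsAt_triples {s : State} {l : List (Fin n)} {f g h : Fin n → ℕ} {a : ℕ}
    (hl : ∀ (k : ℕ) (hk : k < l.length), s.mem (a + 3 * k) = f l[k] ∧
      s.mem (a + 1 + 3 * k) = g l[k] ∧ s.mem (a + 2 + 3 * k) = h l[k]) :
    s.HoldsAt a (l.flatMap fun v => [f v, g v, h v]) := by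
  induction l generalizing a with
  | nil => exact fun i hi => absurd hi (by simp)
  | cons v l ih =>
    obtain ⟨h1, h2, h3⟩ := hl 0 (by simp)
    rw [List.flatMap_cons, State.holdsAt_append]
    refine ⟨?_, ih fun k hk => ?_⟩
    · rw [State.holdsAt_cons, State.holdsAt_cons, State.holdsAt_cons]
      exact ⟨h1, h2, h3, fun i hi => absurd hi (by simp)⟩
    · have h4 := hl (k + 1) (by simpa using hk)
      simp only [List.getElem_cons_succ] at h4
      simp only [List.length_cons, List.length_nil]
      ring_nf at h4 ⊢
      exact h4

/-- The two partners of a vertex in the output are its neighbors of the other color, padded with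
numbers that are not vertices. -/
theorem partners_spec {c l : List ℕ} {x y : ℕ} (hc : c.Nodup) (hlt : ∀ w ∈ c, w < n)
    (hlen : c.length ≤ 2) (h : c.reverse ++ [n, n + 1] = x :: y :: l) :
    x ≠ y ∧ ∀ w < n, w ∈ c ↔ w = x ∨ w = y := by
  have hnd : (c.reverse ++ [n, n + 1]).Nodup := by
    rw [List.nodup_append]
    refine ⟨List.nodup_reverse.2 hc, by simp, fun w hw u hu => ?_⟩
    have := hlt w (List.mem_reverse.1 hw)
    simp only [List.mem_cons, List.not_mem_nil, or_false] at hu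
    omega
  have hmem : ∀ w < n, w ∈ x :: y :: l → w ∈ c := by
    intro w hw hwl
    rw [← h] at hwl
    simp only [List.mem_append, List.mem_reverse, List.mem_cons, List.not_mem_nil, or_false] at hwl
    rcases hwl with hwl | hwl | hwl
    · exact hwl
    · omega
    · omega
  refine ⟨fun hxy => by rw [h, hxy] at hnd; simp at hnd, fun w hw => ⟨fun hwc => ?_, ?_⟩⟩
  -- Since `c` has at most two elements, all of them precede the padding and lie among `x`, `y`.
  · have h1 : c.reverse = (x :: y :: l).take c.length := by
      rw [← h, List.take_left' (by simp)]
    have h2 : w ∈ (x :: y :: l).take 2 :=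
      List.take_subset_take_left _ hlen (h1 ▸ List.mem_reverse.2 hwc)
    simpa using h2
  · rintro (rfl | rfl)
    · exact hmem _ hw (by simp)
    · exact hmem _ hw (by simp)

/-- A successful check has written down a root graph. -/
theorem Success.holdsRootGraph {s : State} (hadj : IsAdjacencyList G adj)
    (hs : Success n (listsOf adj) s) (h1 : s.reg 1 = n * n + 2 * n + 13) {K : ℕ}
    (hK : 4 * (n * n) + 2 * n + 1 ≤ K) : HoldsRootGraph G K s := by
  obtain ⟨-, col, hc, hok, hroot⟩ := hs
  have hA := isGraphInput_listsOf hadj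
  have hcl := (forall_vertexOk_iff hA).1 hok
  choose x y l hl hx hy hcol using fun v : Fin n => hroot.edges v v.2
  have hcross_lt : ∀ v : Fin n, ∀ w ∈ cross (listsOf adj) col v, w < n := fun v w hw =>
    hA.lt v v.2 w (List.mem_of_mem_filter hw)
  have hp := fun v : Fin n => partners_spec (c := cross (listsOf adj) col v)
    ((hA.nodup v v.2).filter _) (hcross_lt v)
    (hcl.cross_le v v.2) (hl v)
  have hle := fun v : Fin n => cons_cons_le (hcross_lt v) (hl v)
  have hpartner : ∀ v w : Fin n, ((w : ℕ) = x v ∨ (w : ℕ) = y v) ↔ G.Adj v w ∧ col w ≠ col v := by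
    intro v w
    rw [← (hp v).2 w w.2, ← mem_listsOf hadj v w, cross, List.mem_filter, decide_eq_true_eq]
  let a : Fin n → Fin (4 * (n * n) + 2 * n + 1) := fun v =>
    ⟨pairCode v (x v), Nat.lt_succ_of_le (pairCode_le v.2 (hle v).1)⟩
  let b : Fin n → Fin (4 * (n * n) + 2 * n + 1) := fun v =>
    ⟨pairCode v (y v), Nat.lt_succ_of_le (pairCode_le v.2 (hle v).2)⟩
  have hmem : ∀ (v : Fin n) z, z ∈ s(a v, b v) ↔
      ∃ u, (u = x v ∨ u = y v) ∧ (z : ℕ) = pairCode v u := by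
    intro v z
    rw [Sym2.mem_iff, Fin.ext_iff, Fin.ext_iff]
    simp [a, b]
  have hshare : ∀ v w : Fin n, v ≠ w → ∀ u u', pairCode v u = pairCode w u' → u = w ∧ u' = v := by
    intro v w hvw u u' h
    rcases pairCode_inj h with h | h
    · exact absurd (Fin.ext h.1) hvw
    · exact ⟨h.2, h.1.symm⟩
  have hab : ∀ v, a v ≠ b v := fun v h => by
    have := pairCode_inj (Fin.ext_iff.1 h)
    have := (hp v).1
    omega
  have hinj : Function.Injective fun v => s(a v, b v) := by
    intro v w h
    by_contra hvw
    -- If two edges coincided, both ends of the edge of `v` would be the pair {v, w}, contradicting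
    -- `x v ≠ y v`.
    have key : ∀ u, u = x v ∨ u = y v → u = w := by
      intro u hu
      have h5 : (⟨pairCode v u, Nat.lt_succ_of_le (pairCode_le v.2 (by
          rcases hu with rfl | rfl; exacts [(hle v).1, (hle v).2]))⟩ :
          Fin (4 * (n * n) + 2 * n + 1)) ∈ s(a v, b v) := (hmem v _).2 ⟨u, hu, rfl⟩
      have h : s(a v, b v) = s(a w, b w) := h
      rw [h, hmem] at h5
      obtain ⟨u', -, h5⟩ := h5
      exact (hshare v w hvw u u' h5).1
    exact (hp v).1 ((key _ (.inl rfl)).trans (key _ (.inr rfl)).symm)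
  have hadj' : ∀ v w : Fin n, v ≠ w → ((∃ z, z ∈ s(a v, b v) ∧ z ∈ s(a w, b w)) ↔ G.Adj v w ∧
      (⟨col v, Nat.lt_succ_of_le (hc v)⟩ : Fin 2) ≠ ⟨col w, Nat.lt_succ_of_le (hc w)⟩) := by
    intro v w hvw
    constructor
    · rintro ⟨z, hz, hz'⟩
      obtain ⟨u, hu, hz⟩ := (hmem v z).1 hz
      obtain ⟨u', -, hz'⟩ := (hmem w z).1 hz'
      rw [(hshare v w hvw u u' (hz.symm.trans hz')).1, hpartner] at hu
      exact ⟨hu.1, fun h => hu.2 (Fin.ext_iff.1 h).symm⟩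
    · rintro ⟨hvw', hne⟩
      have hne : col v ≠ col w := fun h => hne (Fin.ext h)
      have hw := (hpartner v w).2 ⟨hvw', hne.symm⟩
      have hv := (hpartner w v).2 ⟨hvw'.symm, hne⟩
      -- The common endvertex is the code of the pair {v, w}, which is symmetric in both.
      refine ⟨⟨pairCode v w, Nat.lt_succ_of_le (pairCode_le v.2 (by omega))⟩,
        (hmem v _).2 ⟨w, hw, rfl⟩, (hmem w _).2 ⟨v, hv, ?_⟩⟩
      simp only [pairCode, Nat.add_comm (w : ℕ) v]
      omega
  obtain ⟨H, φ, ψ, hφ, hψ, hφψ⟩ := exists_iso_colorLineGraph G a b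
    (fun v => (⟨col v, Nat.lt_succ_of_le (hc v)⟩ : Fin 2)) hab hinj hadj'
    fun v w hvw h => (mem_listsOf hadj v w).1 (hcl.mem v v.2 w w.2
      (fun h => hvw (Fin.ext h)) (Fin.ext_iff.1 h))
  refine ⟨_, H, φ, ψ, a, b, hK, hφ, hψ, ?_⟩
  rw [h1, State.holdsAt_cons]
  refine ⟨hroot.card, holdsAt_triples fun k hk => ?_⟩
  rw [List.length_finRange] at hk
  have h2 := hx ⟨k, hk⟩
  have h3 := hy ⟨k, hk⟩
  have h4 := hcol ⟨k, hk⟩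
  simp only [List.getElem_finRange, hφψ]
  exact ⟨h2, h3, h4⟩

end RAM

/-! ### Assembling the algorithm and its bounds -/

theorem HoldsRootGraph.isProperColorLineGraph {n : ℕ} {G : SimpleGraph (Fin n)} {K : ℕ}
    {s : RAM.State} (h : HoldsRootGraph G K s) : IsProperColorLineGraph 2 G := by
  obtain ⟨p, H, φ, ψ, -, -, -, hφ, -⟩ := h
  exact ⟨Fin p, inferInstance, H, φ, hφ, ⟨ψ⟩⟩

theorem RAM.roomy_pow {n m C : ℕ} (hC : 12 ≤ C) : Roomy ((n + m + 2) ^ C) n := by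
  have h1 : (n + 2) ^ 2 * 2 ^ 10 ≤ (n + m + 2) ^ C := by
    calc (n + 2) ^ 2 * 2 ^ 10 ≤ (n + m + 2) ^ 2 * (n + m + 2) ^ 10 :=
          Nat.mul_le_mul (Nat.pow_le_pow_left (by omega) _) (Nat.pow_le_pow_left (by omega) _)
      _ = (n + m + 2) ^ 12 := by rw [← pow_add]
      _ ≤ _ := Nat.pow_le_pow_right (by omega) hC
  unfold Roomy
  nlinarith

/-- There is one random access machine program that, on every graph `G` with `n` vertices and `m`
edges, given by adjacency lists, halts after `O(n + m)` steps with words of `O(log (n + m))` bits,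
decides (in register `0`) whether `G` is a proper `2`-color-line graph and, if so, has written
down a properly edge `2`-colored root graph of `G`. -/
theorem mainTheorem9 :
    ∃ (P : RAM.Program) (c : ℕ), ∀ (n : ℕ) (G : SimpleGraph (Fin n))
      (adj : Fin n → List (Fin n)), IsAdjacencyList G adj →
      ∃ (t : ℕ) (s : RAM.State),
        RAM.Run ((n + G.edgeSet.ncard + 2) ^ c) P
          (RAM.State.init (encodeAdjacencyList adj)) t s ∧
        t ≤ c * (n + G.edgeSet.ncard + 1) ∧
        (IsProperColorLineGraph 2 G →
          s.reg 0 = 1 ∧ HoldsRootGraph G (c * (n + G.edgeSet.ncard + 1)) s) ∧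
        (¬ IsProperColorLineGraph 2 G → s.reg 0 = 0) := by
  -- The factor 2 comes from the input length 2m + n + 1 ≤ 2(n + m + 1).
  obtain ⟨C, hC⟩ : ∃ C, C = 2 * (1000 + 400 * 4 ^ 12) := ⟨_, rfl⟩
  refine ⟨RAM.recognize, C, fun n G adj hadj => ?_⟩
  have hA := RAM.isGraphInput_listsOf hadj
  have hsum := RAM.sum_length_listsOf hadj
  have hpos : RAM.pos (RAM.listsOf adj) n = 2 * G.edgeSet.ncard + n + 1 := by
    rw [RAM.pos, Finset.sum_add_distrib, hsum, Finset.sum_const, Finset.card_range, smul_eq_mul]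
    omega
  obtain ⟨t, s, hrun, ht, h1, hs⟩ := RAM.halts_recognize hA.toIsInput
    (RAM.roomy_pow (m := G.edgeSet.ncard) (C := C) (by omega)) (RAM.inputAt_init adj)
    (fun _ => rfl) fun a ha => by
      have := hA.toIsInput.pos_le le_rfl
      rw [← RAM.length_encodeAdjacencyList] at this
      exact List.getD_eq_default _ _ (by omega)
  refine ⟨t, s, hrun, ht.trans ?_, ?_⟩
  · rw [hpos, hC]
    omega
  rcases hs with hs | ⟨h0, L, hL, hno, hno'⟩
  · have hroot : HoldsRootGraph G (C * (n + G.edgeSet.ncard + 1)) s := by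
      refine hs.holdsRootGraph hadj h1 ?_
      obtain ⟨-, col, hc, hok, -⟩ := hs
      have := RAM.sq_le_of_vertexOk hc hok
      -- From n² ≤ 4m + 2n one gets 4n² + 2n + 1 ≤ 16m + 10n + 1, so 16 suffices.
      have := Nat.mul_le_mul_right (n + G.edgeSet.ncard + 1) (show 16 ≤ C by omega)
      omega
    exact ⟨fun _ => ⟨hs.1, hroot⟩, fun h => absurd hroot.isProperColorLineGraph h⟩
  · refine ⟨fun h => ?_, fun _ => h0⟩
    obtain ⟨col, hc, hcol⟩ := RAM.exists_isCliqueColoring hadj h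
    rcases RAM.exists_candidate hA hcol hc hL with h | ⟨g, hg, heq, h⟩
    · exact absurd ((RAM.forall_vertexOk_iff hA).2 h) hno
    · exact absurd ((RAM.forall_vertexOk_iff hA).2 h) (hno' g hg heq)
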